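/- Let $G$ be a Lie group with Lie algebra $L(G)$, let $\pi:P\to M$ be a smooth principal $G$-bundle, and let $\overline{A}$ be a connection form on it, with curvature $F^{\overline A}=d\overline A+\frac12[\overline A,\overline A]$, where $[\eta,\zeta](X,Y)=[\eta(X),\zeta(Y)]-[\eta(Y),\zeta(X)]$. A map $c:[t_0,t_1]\to X$ is said to backtrack over $[T,T+\delta]$, where $t_0\le T<T+2\delta<t_1$, if $c(T+u)=c(T+2\delta-u)$ for all $u\in[0,\delta]$; erasing this backtrack produces the map $c_0$ on $[t_0,t_1-2\delta]$ given by $c_0(t)=c(t)$ for $t\in[t_0,T]$ and $c_0(t)=c(t+2\delta)$ for $t\in[T,t_1-2\delta]$. A continuous vector field $\tilde v$ along an $\overline A$-horizontal piecewise $C^1$ path $\tilde\gamma$ in $P$ satisfies the tangency condition if $$\frac{\partial \overline A(\tilde v(t))}{\partial t}=F^{\overline A}\bigl(\tilde\gamma'(t),\tilde v(t)\bigr)$$ at every point $t$ of the domain of $\tilde\gamma$ at which $\tilde\gamma'(t)$ exists (derivatives at the end points of the domain being one-sided). Let $\tilde\gamma:[t_0,t_1]\to P$ be an $\overline A$-horizontal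 piecewise $C^1$ path and let $\tilde v:[t_0,t_1]\to TP$ be a continuous vector field along $\tilde\gamma$ that satisfies the tangency condition. Suppose that the path $\gamma=\pi\circ\tilde\gamma$ backtracks over $[T,T+\delta]$ and that the vector field $v=\pi_*\tilde v$ along $\gamma$, as a map $[t_0,t_1]\to TM$, also backtracks over $[T,T+\delta]$. Then: (i) the path $\tilde\gamma$ backtracks over $[T,T+\delta]$; (ii) the vector field $\tilde v$, as a map $[t_0,t_1]\to TP$, backtracks over $[T,T+\delta]$; (iii) the path $\tilde\gamma_0$ obtained by erasing the backtrack over $[T,T+\delta]$ from $\tilde\gamma$ is an $\overline A$-horizontal piecewise $C^1$ path, and erasing the backtrack over $[T,T+\delta]$ from $\tilde v$ produces a continuous vector field along $\tilde\gamma_0$ that satisfies the tangency condition. -/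

import Mathlib

open Set
open scoped Manifold ContDiff Topology

noncomputable section

/-! ### Paths, backtracking and erasure of backtracks -/

section Paths

/-- The map `c : [t₀, t₁] → X` backtracks over `[T, T + δ]`; only the values of `c` on `[t₀, t₁]`
matter. -/
def BacktracksOver {X : Type*} (c : ℝ → X) (t₀ t₁ T δ : ℝ) : Prop :=
  t₀ ≤ T ∧ T < T + 2 * δ ∧ T + 2 * δ < t₁ ∧
    ∀ u ∈ Icc 0 δ, c (T + u) = c (T + 2 * δ - u)

/-- Erasure of the backtrack over `[T, T + δ]` from `c : [t₀, t₁] → X`, to be regarded as a map on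
`[t₀, t₁ - 2δ]`. -/
def eraseBacktrack {X : Type*} (c : ℝ → X) (T δ : ℝ) : ℝ → X :=
  fun t => if t ≤ T then c t else c (t + 2 * δ)

variable {E : Type*} [NormedAddCommGroup E] [NormedSpace ℝ E]
  {X : Type*} [TopologicalSpace X] [ChartedSpace E X]

/-- `c : [a, b] → X` is piecewise `C¹`: it is continuous, and there are finitely many break points
such that `c` is `C¹` (one-sidedly at the ends) on each closed subinterval with no break point in
its interior. -/
def IsPiecewiseC1 (c : ℝ → X) (a b : ℝ) : Prop :=
  ContinuousOn c (Icc a b) ∧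
    ∃ s : Finset ℝ, ∀ x y : ℝ, x < y → Icc x y ⊆ Icc a b → Disjoint (Ioo x y) (s : Set ℝ) →
      ContMDiffOn 𝓘(ℝ, ℝ) 𝓘(ℝ, E) 1 c (Icc x y)

/-- The path `c : [a, b] → X` has a derivative at `t` (one-sided at `a` and `b`). -/
def HasVelocityAt (c : ℝ → X) (a b t : ℝ) : Prop :=
  MDifferentiableWithinAt 𝓘(ℝ, ℝ) 𝓘(ℝ, E) c (Icc a b) t

/-- The velocity `c'(t) ∈ T_{c(t)} X` of the path `c : [a, b] → X` (one-sided at `a` and `b`). -/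
def velocity (c : ℝ → X) (a b t : ℝ) : TangentSpace 𝓘(ℝ, E) (c t) :=
  mfderivWithin 𝓘(ℝ, ℝ) 𝓘(ℝ, E) c (Icc a b) t (1 : ℝ)

/-- `v : [a, b] → TX` is a continuous vector field along `c : [a, b] → X`. -/
def IsContinuousFieldAlong [IsManifold 𝓘(ℝ, E) 1 X] (c : ℝ → X)
    (v : ℝ → TangentBundle 𝓘(ℝ, E) X) (a b : ℝ) : Prop :=
  ContinuousOn v (Icc a b) ∧ ∀ t ∈ Icc a b, (v t).proj = c t

end Paths

/-! ### Exterior derivative of a vector-valued `1`-form on a manifold -/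

section Forms

variable {E : Type*} [NormedAddCommGroup E] [NormedSpace ℝ E]
  {X : Type*} [TopologicalSpace X] [ChartedSpace E X]
  {F : Type*} [NormedAddCommGroup F] [NormedSpace ℝ F]

/-- The expression in the chart at `p` of an `F`-valued `1`-form `η` on `X`, that is, the pullback
of `η` under the inverse of the chart. -/
def chartForm (η : ∀ q : X, TangentSpace 𝓘(ℝ, E) q →L[ℝ] F) (p : X) (y : E) : E →L[ℝ] F :=
  (η ((extChartAt 𝓘(ℝ, E) p).symm y)).comp
    (mfderiv 𝓘(ℝ, E) 𝓘(ℝ, E) (extChartAt 𝓘(ℝ, E) p).symm y)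

/-- The exterior derivative `dη` at `p` of an `F`-valued `1`-form `η`, computed in the chart at `p`;
the normalisation is `dη(X, Y) = X (η Y) - Y (η X) - η [X, Y]`. -/
def extDerivOneForm (η : ∀ q : X, TangentSpace 𝓘(ℝ, E) q →L[ℝ] F) (p : X)
    (v w : TangentSpace 𝓘(ℝ, E) p) : F :=
  extDeriv (fun y => ContinuousAlternatingMap.ofSubsingleton ℝ E F (0 : Fin 1) (chartForm η p y))
    (extChartAt 𝓘(ℝ, E) p p)
    ![mfderiv 𝓘(ℝ, E) 𝓘(ℝ, E) (extChartAt 𝓘(ℝ, E) p) p v,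
      mfderiv 𝓘(ℝ, E) 𝓘(ℝ, E) (extChartAt 𝓘(ℝ, E) p) p w]

end Forms

/-! ### Principal bundles and connections -/

/-- The adjoint map `Ad(g) : L(G) → L(G)`, the derivative of `x ↦ g x g⁻¹` at the identity. -/
def lieAd {EG : Type*} [NormedAddCommGroup EG] [NormedSpace ℝ EG]
    {G : Type*} [TopologicalSpace G] [ChartedSpace EG G] [Group G] (g : G)
    (Y : GroupLieAlgebra 𝓘(ℝ, EG) G) : GroupLieAlgebra 𝓘(ℝ, EG) G :=
  mfderiv 𝓘(ℝ, EG) 𝓘(ℝ, EG) (fun x : G => g * x * g⁻¹) 1 Y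

section Bundles

variable (EG : Type*) [NormedAddCommGroup EG] [NormedSpace ℝ EG]
  (EP : Type*) [NormedAddCommGroup EP] [NormedSpace ℝ EP]
  (EM : Type*) [NormedAddCommGroup EM] [NormedSpace ℝ EM]
  (G : Type*) [TopologicalSpace G] [ChartedSpace EG G] [Group G]
  (P : Type*) [TopologicalSpace P] [ChartedSpace EP P]
  (M : Type*) [TopologicalSpace M] [ChartedSpace EM M]

/-- A smooth principal `G`-bundle `π : P → M`: a smooth surjection with a smooth free right action
of `G` on `P` preserving the fibres, locally trivial in a `G`-equivariant way. -/
structure PrincipalBundle where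
  /-- The bundle projection `π`. -/
  proj : P → M
  /-- The right action `(p, g) ↦ p g`. -/
  act : P → G → P
  contMDiff_proj : ContMDiff 𝓘(ℝ, EP) 𝓘(ℝ, EM) ∞ proj
  surjective_proj : Function.Surjective proj
  contMDiff_act :
    ContMDiff (𝓘(ℝ, EP).prod 𝓘(ℝ, EG)) 𝓘(ℝ, EP) ∞ (fun x : P × G => act x.1 x.2)
  act_one : ∀ p, act p 1 = p
  act_mul : ∀ p g h, act p (g * h) = act (act p g) h
  act_free : ∀ p g, act p g = p → g = 1
  proj_act : ∀ p g, proj (act p g) = proj p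
  locally_trivial : ∀ x : M, ∃ U : Set M, IsOpen U ∧ x ∈ U ∧
    ∃ φ : PartialDiffeomorph (𝓘(ℝ, EM).prod 𝓘(ℝ, EG)) 𝓘(ℝ, EP) (M × G) P ∞,
      φ.source = U ×ˢ univ ∧ φ.target = proj ⁻¹' U ∧
      ∀ u ∈ U, ∀ g h : G, proj (φ (u, g)) = u ∧ act (φ (u, g)) h = φ (u, g * h)

variable {EG EP EM G P M}

/-- A connection form on a principal bundle: a smooth `L(G)`-valued `1`-form `ω` on `P` with
`ω (X g) = Ad(g⁻¹) (ω X)`, and `ω (Ỹ(p)) = Y` for `Y ∈ L(G)`, where `Ỹ(p)`, the image of `Y` under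
the derivative at `1` of `g ↦ p g`, is the initial velocity of `t ↦ p exp(tY)`. -/
structure ConnectionForm [IsManifold 𝓘(ℝ, EP) 1 P] (B : PrincipalBundle EG EP EM G P M) where
  /-- The underlying `1`-form. -/
  form : ∀ p : P, TangentSpace 𝓘(ℝ, EP) p →L[ℝ] GroupLieAlgebra 𝓘(ℝ, EG) G
  contMDiff_form : ContMDiff 𝓘(ℝ, EP).tangent 𝓘(ℝ, EG) ∞ (M' := EG)
    (fun w : TangentBundle 𝓘(ℝ, EP) P => form w.proj w.snd)
  form_act : ∀ (p : P) (g : G) (X : TangentSpace 𝓘(ℝ, EP) p),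
    form (B.act p g) (mfderiv 𝓘(ℝ, EP) 𝓘(ℝ, EP) (fun q => B.act q g) p X) =
      lieAd g⁻¹ (form p X)
  form_fundamental : ∀ (p : P) (Y : GroupLieAlgebra 𝓘(ℝ, EG) G),
    form (B.act p 1) (mfderiv 𝓘(ℝ, EG) 𝓘(ℝ, EP) (B.act p) 1 Y) = Y

namespace ConnectionForm

variable [IsManifold 𝓘(ℝ, EP) 1 P] {B : PrincipalBundle EG EP EM G P M}

/-- The `2`-form `[η, ζ](X, Y) = [η X, ζ Y] - [η Y, ζ X]`, for `η = ζ = A`. -/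
def bracketForm (A : ConnectionForm B) (p : P) (v w : TangentSpace 𝓘(ℝ, EP) p) :
    GroupLieAlgebra 𝓘(ℝ, EG) G :=
  ⁅A.form p v, A.form p w⁆ - ⁅A.form p w, A.form p v⁆

/-- The exterior derivative `dA`; here `L(G)`, the tangent space of `G` at `1`, is by definition the
vector space `EG`. -/
def extDerivForm (A : ConnectionForm B) (p : P) (v w : TangentSpace 𝓘(ℝ, EP) p) :
    GroupLieAlgebra 𝓘(ℝ, EG) G :=
  extDerivOneForm (F := EG) A.form p v w

/-- The curvature `2`-form `dA + ½ [A, A]`. -/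
def curvature (A : ConnectionForm B) (p : P) (v w : TangentSpace 𝓘(ℝ, EP) p) :
    GroupLieAlgebra 𝓘(ℝ, EG) G :=
  A.extDerivForm p v w + (1 / 2 : ℝ) • A.bracketForm p v w

/-- The path `c : [a, b] → P` is horizontal: `A(c'(t)) = 0` wherever `c'(t)` exists. -/
def IsHorizontal (A : ConnectionForm B) (c : ℝ → P) (a b : ℝ) : Prop :=
  ∀ t ∈ Icc a b, HasVelocityAt (E := EP) c a b t → A.form (c t) (velocity c a b t) = 0

/-- The tangency condition for a vector field `v` along `c : [a, b] → P`:
`∂A(v(t))/∂t = F(c'(t), v(t))` at every point `t` of `[a, b]` at which `c'(t)` exists. Here `w` is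
`v t`, regarded as an element of `T_{c(t)} P`. -/
def TangencyCondition (A : ConnectionForm B) (c : ℝ → P) (v : ℝ → TangentBundle 𝓘(ℝ, EP) P)
    (a b : ℝ) : Prop :=
  ∀ t ∈ Icc a b, HasVelocityAt (E := EP) c a b t →
    ∀ w : TangentSpace 𝓘(ℝ, EP) (c t), v t = ⟨c t, w⟩ →
      HasDerivWithinAt (fun s => A.form (v s).proj (v s).snd)
        (A.curvature (c t) (velocity c a b t) w) (Icc a b) t

end ConnectionForm

end Bundles

end

/-! Read outward from the turning point `T + δ`, the two halves of the backtrack are horizontal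
paths u ↦ c (T + δ ± u) with a common starting point and the same projection to M. Two such lifts
differ locally by a curve h in G, horizontality of both forces h' = 0 off the break points, so h
stays at 1 and the halves agree (`eqOn_of_horizontal`).

For the field, the curvature F(c', ·) along a horizontal path is just dA(c', ·)
(`curvature_of_horizontal`), and the tangency condition survives reparametrisation, since both of
its sides scale by the same factor. Two solutions along one path with the same projection differ by
a vertical vector, and dA vanishes on a horizontal and a vertical vector (`extDerivForm_eq_zero`).
Hence A(v₁) - A(v₂) is constant, and it is 0 at the turning point. Since A and the derivative of the
projection together determine a tangent vector, v₁ = v₂ (`eqOn_of_isTangentAt`).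

After erasure, path and field are locally the old ones up to a shift of time, so all conditions hold
off a finite set. The delicate points are the exceptional ones: at T the erased path may have a
velocity although the original path has none there. On each closed C¹ piece A(c') and dA(c', v) are
continuous, so the conditions pass to the end points with one-sided derivatives
(`one_sided_of_isTangentAt`); where a two-sided velocity exists, the two sides glue
(`isHorizontal_and_tangencyCondition_of_isTangentAt`). -/

/-! ### Exterior derivative of a 1-form on a normed space -/

section Calculus

variable {E : Type*} [NormedAddCommGroup E] [NormedSpace ℝ E]
  {F : Type*} [NormedAddCommGroup F] [NormedSpace ℝ F]
  {W : Type*} [NormedAddCommGroup W] [NormedSpace ℝ W]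

theorem extDeriv_ofSubsingleton_apply {η : E → E →L[ℝ] F} {x : E} (h : DifferentiableAt ℝ η x)
    (v w : E) :
    extDeriv (fun y => ContinuousAlternatingMap.ofSubsingleton ℝ E F (0 : Fin 1) (η y)) x ![v, w] =
      fderiv ℝ η x v w - fderiv ℝ η x w v := by
  have h' : DifferentiableAt ℝ
      (fun y => ContinuousAlternatingMap.ofSubsingleton ℝ E F (0 : Fin 1) (η y)) x :=
    (ContinuousAlternatingMap.ofSubsingletonLIE (𝕜 := ℝ) (E := E) (F := F)
      (0 : Fin 1)).toContinuousLinearEquiv.differentiableAt.comp x h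
  have key : ∀ u : E, fderiv ℝ (fun y => η y u) x = (fderiv ℝ η x).flip u := fun u => by
    ext z
    rw [fderiv_clm_apply h (differentiableAt_const u)]
    simp
  rw [extDeriv_apply h']
  simp [Fin.sum_univ_two, Fin.removeNth, key, sub_eq_add_neg]

/-- The product rule gives an extra term in the second derivative of `f`, which is symmetric and
cancels in the antisymmetrisation. -/
theorem fderiv_pullback_oneForm {η : E → E →L[ℝ] F} {f : W → E} {x : W}
    (hf : ContDiffAt ℝ 2 f x) (hη : DifferentiableAt ℝ η (f x)) (a b : W) :
    fderiv ℝ (fun y => η (f y) (fderiv ℝ f y b)) x a -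
        fderiv ℝ (fun y => η (f y) (fderiv ℝ f y a)) x b =
      fderiv ℝ η (f x) (fderiv ℝ f x a) (fderiv ℝ f x b) -
        fderiv ℝ η (f x) (fderiv ℝ f x b) (fderiv ℝ f x a) := by
  have hdf : DifferentiableAt ℝ f x := hf.differentiableAt (by norm_num)
  have hd2 : DifferentiableAt ℝ (fderiv ℝ f) x :=
    (hf.fderiv_right (m := 1) (by norm_num)).differentiableAt (by norm_num)
  have hsymm : IsSymmSndFDerivAt ℝ f x := hf.isSymmSndFDerivAt (by simp)
  have key : ∀ u z : W, fderiv ℝ (fun y => η (f y) (fderiv ℝ f y u)) x z =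
      fderiv ℝ η (f x) (fderiv ℝ f x z) (fderiv ℝ f x u) +
        η (f x) (fderiv ℝ (fderiv ℝ f) x z u) := fun u z => by
    have h1 : HasFDerivAt (fun y => η (f y)) ((fderiv ℝ η (f x)).comp (fderiv ℝ f x)) x :=
      hη.hasFDerivAt.comp x hdf.hasFDerivAt
    have h2 : HasFDerivAt (fun y => fderiv ℝ f y u) ((fderiv ℝ (fderiv ℝ f) x).flip u) x := by
      simpa using hd2.hasFDerivAt.clm_apply (hasFDerivAt_const u x)
    rw [(h1.clm_apply h2).fderiv]
    simp [add_comm]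
  rw [key, key, hsymm.eq a b]
  abel

end Calculus

/-! ### Exterior derivative on a manifold: pullback, independence of the chart, continuity -/

section ManifoldForms

variable {E : Type*} [NormedAddCommGroup E] [NormedSpace ℝ E]
  {X : Type*} [TopologicalSpace X] [ChartedSpace E X]
  {F : Type*} [NormedAddCommGroup F] [NormedSpace ℝ F]
  {W : Type*} [NormedAddCommGroup W] [NormedSpace ℝ W]

theorem mfderiv_extChartAt_symm_apply_mfderiv_extChartAt [IsManifold 𝓘(ℝ, E) 1 X] {p q : X}
    (hq : q ∈ (extChartAt 𝓘(ℝ, E) p).source) (u : TangentSpace 𝓘(ℝ, E) q) :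
    (mfderiv 𝓘(ℝ, E) 𝓘(ℝ, E) (extChartAt 𝓘(ℝ, E) p).symm (extChartAt 𝓘(ℝ, E) p q)
      (mfderiv 𝓘(ℝ, E) 𝓘(ℝ, E) (extChartAt 𝓘(ℝ, E) p) q u) : E) = u := by
  have h := mfderivWithin_extChartAt_symm_comp_mfderiv_extChartAt' (I := 𝓘(ℝ, E)) hq
  simp only [modelWithCornersSelf_coe, range_id, mfderivWithin_univ] at h
  exact congrArg (fun L => L u) h

theorem chartForm_extChartAt [IsManifold 𝓘(ℝ, E) 1 X]
    (η : ∀ q : X, TangentSpace 𝓘(ℝ, E) q →L[ℝ] F) {p q : X}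
    (hq : q ∈ (extChartAt 𝓘(ℝ, E) p).source) (u : TangentSpace 𝓘(ℝ, E) q) :
    chartForm η p (extChartAt 𝓘(ℝ, E) p q) (mfderiv 𝓘(ℝ, E) 𝓘(ℝ, E) (extChartAt 𝓘(ℝ, E) p) q u) =
      η q u := by
  -- The two base points are equal only propositionally. All tangent spaces unfold to the model
  -- space, so a vector is kept fixed while its base point is replaced; the same device recurs
  -- below.
  have hcongr : ∀ q' : X, q' = q → ∀ w : E, η q' w = η q w := by
    rintro _ rfl _; rfl
  have := hcongr _ ((extChartAt 𝓘(ℝ, E) p).left_inv hq)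
    (mfderiv 𝓘(ℝ, E) 𝓘(ℝ, E) (extChartAt 𝓘(ℝ, E) p).symm (extChartAt 𝓘(ℝ, E) p q)
      (mfderiv 𝓘(ℝ, E) 𝓘(ℝ, E) (extChartAt 𝓘(ℝ, E) p) q u))
  refine this.trans ?_
  exact congrArg (η q) (mfderiv_extChartAt_symm_apply_mfderiv_extChartAt hq u)

/-- In finite dimension smoothness may be tested on each fixed vector `e`; there the form is `η`
composed with the tangent map of the inverse chart along the constant field `e`. -/
theorem contDiffOn_chartForm [FiniteDimensional ℝ E] [IsManifold 𝓘(ℝ, E) ∞ X]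
    {η : ∀ q : X, TangentSpace 𝓘(ℝ, E) q →L[ℝ] F}
    (hη : ContMDiff 𝓘(ℝ, E).tangent 𝓘(ℝ, F) ∞
      (fun w : TangentBundle 𝓘(ℝ, E) X => η w.proj w.snd)) (p : X) :
    ContDiffOn ℝ ∞ (chartForm η p) (extChartAt 𝓘(ℝ, E) p).target := by
  rw [contDiffOn_clm_apply]
  intro e
  have hopen : IsOpen (extChartAt 𝓘(ℝ, E) p).target := isOpen_extChartAt_target p
  have h1 : ContMDiffOn 𝓘(ℝ, E) 𝓘(ℝ, E) ∞ (extChartAt 𝓘(ℝ, E) p).symm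
      (extChartAt 𝓘(ℝ, E) p).target := contMDiffOn_extChartAt_symm p
  have h2 := h1.contMDiffOn_tangentMapWithin (m := ∞) (by simp) hopen.uniqueMDiffOn
  have h3 : ContMDiff 𝓘(ℝ, E) 𝓘(ℝ, E).tangent ∞
      (fun y : E => (⟨y, e⟩ : TangentBundle 𝓘(ℝ, E) E)) := by
    intro y
    exact contMDiffAt_vectorSpace_iff_contDiffAt.2 contDiffAt_const
  have h4 := hη.comp_contMDiffOn (h2.comp h3.contMDiffOn (s := (extChartAt 𝓘(ℝ, E) p).target)
    (fun y hy => hy))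
  rw [← contMDiffOn_iff_contDiffOn]
  refine h4.congr fun y hy => ?_
  simp only [Function.comp, tangentMapWithin, mfderivWithin_of_isOpen hopen hy]
  rfl

theorem differentiableAt_chartForm [FiniteDimensional ℝ E] [IsManifold 𝓘(ℝ, E) ∞ X]
    {η : ∀ q : X, TangentSpace 𝓘(ℝ, E) q →L[ℝ] F}
    (hη : ContMDiff 𝓘(ℝ, E).tangent 𝓘(ℝ, F) ∞
      (fun w : TangentBundle 𝓘(ℝ, E) X => η w.proj w.snd)) {p : X} {y : E}
    (hy : y ∈ (extChartAt 𝓘(ℝ, E) p).target) :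
    DifferentiableAt ℝ (chartForm η p) y :=
  ((contDiffOn_chartForm hη p).differentiableOn (by simp)).differentiableAt
    ((isOpen_extChartAt_target p).mem_nhds hy)

theorem fderiv_extChartAt_comp_apply [IsManifold 𝓘(ℝ, E) 1 X] {f : W → X} {p : X} {y : W}
    (hf : MDifferentiableAt 𝓘(ℝ, W) 𝓘(ℝ, E) f y)
    (hy : f y ∈ (extChartAt 𝓘(ℝ, E) p).source) (b : W) :
    fderiv ℝ (fun z => extChartAt 𝓘(ℝ, E) p (f z)) y b =
      mfderiv 𝓘(ℝ, E) 𝓘(ℝ, E) (extChartAt 𝓘(ℝ, E) p) (f y)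
        (mfderiv 𝓘(ℝ, W) 𝓘(ℝ, E) f y b) := by
  have h := mfderiv_comp (I := 𝓘(ℝ, W)) (I' := 𝓘(ℝ, E)) (I'' := 𝓘(ℝ, E)) y
    (mdifferentiableAt_extChartAt (I := 𝓘(ℝ, E)) (x := p) (y := f y)
      (by rwa [extChartAt_source] at hy)) hf
  rw [mfderiv_eq_fderiv] at h
  exact congrArg (fun L => L b) h

/-- The exterior derivative commutes with pullback along a `C²` map from a normed space. -/
theorem extDerivOneForm_pullback [FiniteDimensional ℝ E] [IsManifold 𝓘(ℝ, E) ∞ X]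
    {η : ∀ q : X, TangentSpace 𝓘(ℝ, E) q →L[ℝ] F}
    (hη : ContMDiff 𝓘(ℝ, E).tangent 𝓘(ℝ, F) ∞
      (fun w : TangentBundle 𝓘(ℝ, E) X => η w.proj w.snd))
    {f : W → X} {x : W} (hf : ContMDiffAt 𝓘(ℝ, W) 𝓘(ℝ, E) 2 f x) (a b : W) :
    extDerivOneForm η (f x) (mfderiv 𝓘(ℝ, W) 𝓘(ℝ, E) f x a) (mfderiv 𝓘(ℝ, W) 𝓘(ℝ, E) f x b) =
      fderiv ℝ (fun y => η (f y) (mfderiv 𝓘(ℝ, W) 𝓘(ℝ, E) f y b)) x a -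
        fderiv ℝ (fun y => η (f y) (mfderiv 𝓘(ℝ, W) 𝓘(ℝ, E) f y a)) x b := by
  have hX2 : IsManifold 𝓘(ℝ, E) 2 X := inferInstance
  have hev : ∀ᶠ y in 𝓝 x, MDifferentiableAt 𝓘(ℝ, W) 𝓘(ℝ, E) f y := by
    filter_upwards [(contMDiffAt_iff_contMDiffAt_nhds (by simp)).1 hf] with y hy
    exact hy.mdifferentiableAt (by simp)
  have hsrc : ∀ᶠ y in 𝓝 x, f y ∈ (extChartAt 𝓘(ℝ, E) (f x)).source :=
    hf.continuousAt.eventually (extChartAt_source_mem_nhds (f x))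
  have hfh : ContDiffAt ℝ 2 (fun z => extChartAt 𝓘(ℝ, E) (f x) (f z)) x :=
    contMDiffAt_iff_contDiffAt.1 ((contMDiffAt_extChartAt (n := 2)).comp x hf)
  -- Near `x` the pullback of `η` by `f` is the pullback of its chart expression by the chart
  -- expression of `f`, which reduces the claim to normed spaces.
  have hpull : ∀ u : W, (fun y => η (f y) (mfderiv 𝓘(ℝ, W) 𝓘(ℝ, E) f y u)) =ᶠ[𝓝 x]
      fun y => chartForm η (f x) (extChartAt 𝓘(ℝ, E) (f x) (f y))
        (fderiv ℝ (fun z => extChartAt 𝓘(ℝ, E) (f x) (f z)) y u) := fun u => by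
    filter_upwards [hev, hsrc] with y hy hys
    rw [fderiv_extChartAt_comp_apply hy hys]
    exact (chartForm_extChartAt η hys _).symm
  have hd := differentiableAt_chartForm hη (mem_extChartAt_target (I := 𝓘(ℝ, E)) (f x))
  rw [(hpull a).fderiv_eq, (hpull b).fderiv_eq,
    fderiv_pullback_oneForm (f := fun z => extChartAt 𝓘(ℝ, E) (f x) (f z)) hfh hd]
  rw [fderiv_extChartAt_comp_apply hev.self_of_nhds hsrc.self_of_nhds,
    fderiv_extChartAt_comp_apply hev.self_of_nhds hsrc.self_of_nhds]
  exact extDeriv_ofSubsingleton_apply hd _ _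

/-- The exterior derivative may be computed in any chart. -/
theorem extDerivOneForm_eq_chart [FiniteDimensional ℝ E] [IsManifold 𝓘(ℝ, E) ∞ X]
    {η : ∀ q : X, TangentSpace 𝓘(ℝ, E) q →L[ℝ] F}
    (hη : ContMDiff 𝓘(ℝ, E).tangent 𝓘(ℝ, F) ∞
      (fun w : TangentBundle 𝓘(ℝ, E) X => η w.proj w.snd))
    {p q : X} (hq : q ∈ (extChartAt 𝓘(ℝ, E) p).source) (v w : TangentSpace 𝓘(ℝ, E) q) :
    extDerivOneForm η q v w =
      fderiv ℝ (chartForm η p) (extChartAt 𝓘(ℝ, E) p q)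
          (mfderiv 𝓘(ℝ, E) 𝓘(ℝ, E) (extChartAt 𝓘(ℝ, E) p) q v)
          (mfderiv 𝓘(ℝ, E) 𝓘(ℝ, E) (extChartAt 𝓘(ℝ, E) p) q w) -
        fderiv ℝ (chartForm η p) (extChartAt 𝓘(ℝ, E) p q)
          (mfderiv 𝓘(ℝ, E) 𝓘(ℝ, E) (extChartAt 𝓘(ℝ, E) p) q w)
          (mfderiv 𝓘(ℝ, E) 𝓘(ℝ, E) (extChartAt 𝓘(ℝ, E) p) q v) := by
  set y := extChartAt 𝓘(ℝ, E) p q with hy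
  have hyt : y ∈ (extChartAt 𝓘(ℝ, E) p).target := (extChartAt 𝓘(ℝ, E) p).map_source hq
  have hX2 : IsManifold 𝓘(ℝ, E) 2 X := inferInstance
  have hf : ContMDiffAt 𝓘(ℝ, E) 𝓘(ℝ, E) 2 (extChartAt 𝓘(ℝ, E) p).symm y :=
    (contMDiffOn_extChartAt_symm p).contMDiffAt ((isOpen_extChartAt_target p).mem_nhds hyt)
  -- The map pulled back along is the inverse of the chart at `p`; its derivative undoes that of the
  -- chart.
  have key := extDerivOneForm_pullback hη hf
    (mfderiv 𝓘(ℝ, E) 𝓘(ℝ, E) (extChartAt 𝓘(ℝ, E) p) q v)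
    (mfderiv 𝓘(ℝ, E) 𝓘(ℝ, E) (extChartAt 𝓘(ℝ, E) p) q w)
  have hd := differentiableAt_chartForm hη hyt
  have hfd : ∀ a b : E, fderiv ℝ (fun z => chartForm η p z b) y a =
      fderiv ℝ (chartForm η p) y a b := fun a b => by
    rw [fderiv_clm_apply hd (differentiableAt_const b)]
    simp
  have hcongr : ∀ q' : X, q' = q → ∀ v' w' : E,
      extDerivOneForm η q' v' w' = extDerivOneForm η q v' w' := by
    rintro _ rfl _ _; rfl
  have h1 := mfderiv_extChartAt_symm_apply_mfderiv_extChartAt hq v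
  have h2 := mfderiv_extChartAt_symm_apply_mfderiv_extChartAt hq w
  have h3 := hcongr _ ((extChartAt 𝓘(ℝ, E) p).left_inv hq)
    (mfderiv 𝓘(ℝ, E) 𝓘(ℝ, E) (extChartAt 𝓘(ℝ, E) p).symm y
      (mfderiv 𝓘(ℝ, E) 𝓘(ℝ, E) (extChartAt 𝓘(ℝ, E) p) q v))
    (mfderiv 𝓘(ℝ, E) 𝓘(ℝ, E) (extChartAt 𝓘(ℝ, E) p).symm y
      (mfderiv 𝓘(ℝ, E) 𝓘(ℝ, E) (extChartAt 𝓘(ℝ, E) p) q w))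
  have h4 := key.symm.trans (h3.trans (congrArg₂ (fun a b : E => extDerivOneForm η q a b) h1 h2))
  exact h4.symm.trans (congrArg₂ (· - ·) (hfd _ _) (hfd _ _))

/-- The components in the chart at `p` of a continuous vector field along a map are continuous. -/
theorem ContinuousWithinAt.mfderiv_extChartAt_snd [IsManifold 𝓘(ℝ, E) ∞ X]
    {Y : Type*} [TopologicalSpace Y] {S : Set Y} {y₀ : Y} {V : Y → TangentBundle 𝓘(ℝ, E) X}
    (hV : ContinuousWithinAt V S y₀) {p : X}
    (hp : (V y₀).proj ∈ (extChartAt 𝓘(ℝ, E) p).source) :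
    ContinuousWithinAt (fun y => (mfderiv 𝓘(ℝ, E) 𝓘(ℝ, E) (extChartAt 𝓘(ℝ, E) p) (V y).proj
      (V y).snd : E)) S y₀ := by
  have hopen : IsOpen (extChartAt 𝓘(ℝ, E) p).source := isOpen_extChartAt_source p
  have h1 : ContMDiffOn 𝓘(ℝ, E) 𝓘(ℝ, E) 1 (extChartAt 𝓘(ℝ, E) p)
      (extChartAt 𝓘(ℝ, E) p).source := by
    rw [extChartAt_source]; exact contMDiffOn_extChartAt
  have h2 := h1.continuousOn_tangentMapWithin le_rfl hopen.uniqueMDiffOn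
  have hpre : IsOpen (Bundle.TotalSpace.proj ⁻¹' (extChartAt 𝓘(ℝ, E) p).source :
      Set (TangentBundle 𝓘(ℝ, E) X)) := hopen.preimage (FiberBundle.continuous_proj E _)
  have h3 := (h2.continuousAt (hpre.mem_nhds hp)).comp_continuousWithinAt hV
  have h4 : Continuous (fun w : TangentBundle 𝓘(ℝ, E) E => (w.snd : E)) :=
    (contMDiff_snd_tangentBundle_modelSpace E 𝓘(ℝ, E) (n := 0)).continuous
  have h5 := h4.continuousAt.comp_continuousWithinAt h3
  refine h5.congr_of_eventuallyEq ?_ ?_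
  · filter_upwards [hV.eventually (hpre.mem_nhds hp)] with y hy
    simp only [Function.comp, tangentMapWithin, mfderivWithin_of_isOpen hopen hy]
    rfl
  · simp only [Function.comp, tangentMapWithin, mfderivWithin_of_isOpen hopen hp]
    rfl

/-- The definition uses the chart at the moving point, which may jump. Rewriting everything in the
single chart at the limit point leaves an expression continuous in the components. -/
theorem ContinuousWithinAt.extDerivOneForm [FiniteDimensional ℝ E] [IsManifold 𝓘(ℝ, E) ∞ X]
    {η : ∀ q : X, TangentSpace 𝓘(ℝ, E) q →L[ℝ] F}
    (hη : ContMDiff 𝓘(ℝ, E).tangent 𝓘(ℝ, F) ∞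
      (fun w : TangentBundle 𝓘(ℝ, E) X => η w.proj w.snd))
    {Y : Type*} [TopologicalSpace Y] {S : Set Y} {y₀ : Y} {V W : Y → TangentBundle 𝓘(ℝ, E) X}
    (hV : ContinuousWithinAt V S y₀) (hW : ContinuousWithinAt W S y₀) (hy₀ : y₀ ∈ S)
    (hVW : ∀ y ∈ S, (W y).proj = (V y).proj) :
    ContinuousWithinAt (fun y => extDerivOneForm η (V y).proj (V y).snd (W y).snd) S y₀ := by
  set p := (V y₀).proj with hp
  have hps : p ∈ (extChartAt 𝓘(ℝ, E) p).source := mem_extChartAt_source p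
  have hproj : ContinuousWithinAt (fun y => (V y).proj) S y₀ :=
    (FiberBundle.continuous_proj E (TangentSpace 𝓘(ℝ, E) (M := X))).continuousAt
      |>.comp_continuousWithinAt hV
  have hv := hV.mfderiv_extChartAt_snd hps
  have hw := hW.mfderiv_extChartAt_snd (p := p) (by rw [hVW y₀ hy₀]; exact hps)
  have hchart : ContinuousWithinAt
      (fun y => fderiv ℝ (chartForm η p) (extChartAt 𝓘(ℝ, E) p (V y).proj)) S y₀ := by
    have h1 : ContinuousOn (fderiv ℝ (chartForm η p)) (extChartAt 𝓘(ℝ, E) p).target :=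
      (contDiffOn_chartForm hη p).continuousOn_fderiv_of_isOpen (isOpen_extChartAt_target p)
        (by simp)
    have h2 := h1.continuousAt (extChartAt_target_mem_nhds p)
    exact ContinuousAt.comp_continuousWithinAt (f := fun y => extChartAt 𝓘(ℝ, E) p (V y).proj) h2
      (ContinuousAt.comp_continuousWithinAt (f := fun y => (V y).proj)
        (continuousAt_extChartAt p) hproj)
  have hlim := ((hchart.clm_apply hv).clm_apply hw).sub ((hchart.clm_apply hw).clm_apply hv)
  have hcongr : ∀ (q q' : X), q' = q → ∀ w : E,
      (mfderiv 𝓘(ℝ, E) 𝓘(ℝ, E) (extChartAt 𝓘(ℝ, E) p) q' w : E) =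
        mfderiv 𝓘(ℝ, E) 𝓘(ℝ, E) (extChartAt 𝓘(ℝ, E) p) q w := by
    rintro _ _ rfl _; rfl
  have heq : ∀ y ∈ S, (V y).proj ∈ (extChartAt 𝓘(ℝ, E) p).source →
      _root_.extDerivOneForm η (V y).proj (V y).snd (W y).snd = _ := fun y hyS hy =>
    (extDerivOneForm_eq_chart hη hy (V y).snd (W y).snd).trans
      (congrArg (fun u : E =>
        fderiv ℝ (chartForm η p) (extChartAt 𝓘(ℝ, E) p (V y).proj)
          (mfderiv 𝓘(ℝ, E) 𝓘(ℝ, E) (extChartAt 𝓘(ℝ, E) p) (V y).proj (V y).snd) u -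
        fderiv ℝ (chartForm η p) (extChartAt 𝓘(ℝ, E) p (V y).proj) u
          (mfderiv 𝓘(ℝ, E) 𝓘(ℝ, E) (extChartAt 𝓘(ℝ, E) p) (V y).proj (V y).snd))
        (hcongr _ _ (hVW y hyS) (W y).snd).symm)
  refine hlim.congr_of_eventuallyEq ?_ (heq y₀ hy₀ hps)
  filter_upwards [self_mem_nhdsWithin, hproj.eventually
    (extChartAt_source_mem_nhds (I := 𝓘(ℝ, E)) p)]
    with y hyS hy
  exact heq y hyS hy

variable [FiniteDimensional ℝ E] [IsManifold 𝓘(ℝ, E) ∞ X]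
  {η : ∀ q : X, TangentSpace 𝓘(ℝ, E) q →L[ℝ] F}

theorem extDerivOneForm_sub_right
    (hη : ContMDiff 𝓘(ℝ, E).tangent 𝓘(ℝ, F) ∞
      (fun w : TangentBundle 𝓘(ℝ, E) X => η w.proj w.snd)) {q : X}
    (u v w : TangentSpace 𝓘(ℝ, E) q) :
    extDerivOneForm η q u (v - w) = extDerivOneForm η q u v - extDerivOneForm η q u w := by
  have h := mem_extChartAt_source (I := 𝓘(ℝ, E)) q
  have hs : (mfderiv 𝓘(ℝ, E) 𝓘(ℝ, E) (extChartAt 𝓘(ℝ, E) q) q (v - w) : E) =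
    (mfderiv 𝓘(ℝ, E) 𝓘(ℝ, E) (extChartAt 𝓘(ℝ, E) q) q v : E) -
      (mfderiv 𝓘(ℝ, E) 𝓘(ℝ, E) (extChartAt 𝓘(ℝ, E) q) q w : E) := map_sub _ _ _
  have key : ∀ (L : E →L[ℝ] E →L[ℝ] F) (a b c d : E), d = b - c →
      L a d - L d a = (L a b - L b a) - (L a c - L c a) := by
    rintro L a b c _ rfl
    simp only [map_sub, sub_apply]
    abel
  exact (extDerivOneForm_eq_chart hη h u (v - w)).trans ((key _ _ _ _ _ hs).trans
    (congrArg₂ (· - ·) (extDerivOneForm_eq_chart hη h u v)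
      (extDerivOneForm_eq_chart hη h u w)).symm)

theorem extDerivOneForm_smul_left
    (hη : ContMDiff 𝓘(ℝ, E).tangent 𝓘(ℝ, F) ∞
      (fun w : TangentBundle 𝓘(ℝ, E) X => η w.proj w.snd)) {q : X}
    (r : ℝ) (v w : TangentSpace 𝓘(ℝ, E) q) :
    extDerivOneForm η q (r • v) w = r • extDerivOneForm η q v w := by
  have h := mem_extChartAt_source (I := 𝓘(ℝ, E)) q
  have hs : (mfderiv 𝓘(ℝ, E) 𝓘(ℝ, E) (extChartAt 𝓘(ℝ, E) q) q (r • v) : E) =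
    r • (mfderiv 𝓘(ℝ, E) 𝓘(ℝ, E) (extChartAt 𝓘(ℝ, E) q) q v : E) := map_smul _ _ _
  have key : ∀ (L : E →L[ℝ] E →L[ℝ] F) (a b d : E), d = r • b →
      L d a - L a d = r • (L b a - L a b) := by
    rintro L a b _ rfl
    simp only [map_smul, smul_apply, smul_sub]
  exact (extDerivOneForm_eq_chart hη h (r • v) w).trans ((key _ _ _ _ hs).trans
    (congrArg (r • ·) (extDerivOneForm_eq_chart hη h v w)).symm)

end ManifoldForms

/-! ### The group action, local sections, and the connection form on orbits -/

section PrincipalBundles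

variable {EG : Type*} [NormedAddCommGroup EG] [NormedSpace ℝ EG]
  {EP : Type*} [NormedAddCommGroup EP] [NormedSpace ℝ EP]
  {EM : Type*} [NormedAddCommGroup EM] [NormedSpace ℝ EM]
  {G : Type*} [TopologicalSpace G] [ChartedSpace EG G] [Group G]
  {P : Type*} [TopologicalSpace P] [ChartedSpace EP P]
  {M : Type*} [TopologicalSpace M] [ChartedSpace EM M]

theorem eq_zero_of_mfderiv_mul_left_eq_zero [LieGroup 𝓘(ℝ, EG) ∞ G] {g h : G}
    {w : TangentSpace 𝓘(ℝ, EG) h}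
    (hw : (mfderiv 𝓘(ℝ, EG) 𝓘(ℝ, EG) (fun x : G => g * x) h w : EG) = 0) : (w : EG) = 0 := by
  have hd : ∀ a b : G, MDifferentiableAt 𝓘(ℝ, EG) 𝓘(ℝ, EG) (fun x : G => a * x) b := fun a b =>
    (contMDiff_mul_left (I := 𝓘(ℝ, EG)) (n := ∞) (a := a)).contMDiffAt.mdifferentiableAt (by simp)
  have h1 := mfderiv_comp (I := 𝓘(ℝ, EG)) (I' := 𝓘(ℝ, EG)) (I'' := 𝓘(ℝ, EG)) h
    (hd g⁻¹ (g * h)) (hd g h)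
  have h2 : (fun x : G => g⁻¹ * x) ∘ (fun x : G => g * x) = id := by ext x; simp
  rw [h2, mfderiv_id] at h1
  have h3 := congrArg (fun L => L w) h1
  refine h3.trans ?_
  exact (congrArg (mfderiv 𝓘(ℝ, EG) 𝓘(ℝ, EG) (fun x : G => g⁻¹ * x) (g * h)) hw).trans
    (map_zero _)

namespace PrincipalBundle

variable (B : PrincipalBundle EG EP EM G P M)

theorem contMDiff_act_right (p : P) : ContMDiff 𝓘(ℝ, EG) 𝓘(ℝ, EP) ∞ (B.act p) :=
  B.contMDiff_act.comp (contMDiff_const.prodMk contMDiff_id)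

/-- The Leibniz rule for the group action. -/
theorem mfderiv_act_comp {E : Type*} [NormedAddCommGroup E] [NormedSpace ℝ E]
    {N : Type*} [TopologicalSpace N] [ChartedSpace E N] {a : N → P} {b : N → G} {n : N}
    (ha : MDifferentiableAt 𝓘(ℝ, E) 𝓘(ℝ, EP) a n) (hb : MDifferentiableAt 𝓘(ℝ, E) 𝓘(ℝ, EG) b n)
    (w : TangentSpace 𝓘(ℝ, E) n) :
    mfderiv 𝓘(ℝ, E) 𝓘(ℝ, EP) (fun x => B.act (a x) (b x)) n w =
      mfderiv 𝓘(ℝ, EP) 𝓘(ℝ, EP) (fun q => B.act q (b n)) (a n)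
          (mfderiv 𝓘(ℝ, E) 𝓘(ℝ, EP) a n w) +
        mfderiv 𝓘(ℝ, EG) 𝓘(ℝ, EP) (B.act (a n)) (b n) (mfderiv 𝓘(ℝ, E) 𝓘(ℝ, EG) b n w) := by
  have hact : MDifferentiableAt (𝓘(ℝ, EP).prod 𝓘(ℝ, EG)) 𝓘(ℝ, EP)
      (fun x : P × G => B.act x.1 x.2) (a n, b n) :=
    B.contMDiff_act.contMDiffAt.mdifferentiableAt (by simp)
  have h1 := mfderiv_comp (I := 𝓘(ℝ, E)) (I' := 𝓘(ℝ, EP).prod 𝓘(ℝ, EG)) (I'' := 𝓘(ℝ, EP)) n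
    (f := fun x => (a x, b x)) (g := fun x : P × G => B.act x.1 x.2) hact (ha.prodMk hb)
  have h2 := congrArg (fun L => L w) h1
  refine h2.trans ?_
  have h3 := mfderiv_prod_eq_add_apply (I := 𝓘(ℝ, EP)) (I' := 𝓘(ℝ, EG)) (I'' := 𝓘(ℝ, EP)) hact
    (v := mfderiv 𝓘(ℝ, E) (𝓘(ℝ, EP).prod 𝓘(ℝ, EG)) (fun x => (a x, b x)) n w)
  refine h3.trans ?_
  have h4 := congrArg (fun L => L w) (ha.mfderiv_prod hb)
  have h5 : (mfderiv 𝓘(ℝ, E) (𝓘(ℝ, EP).prod 𝓘(ℝ, EG)) (fun x => (a x, b x)) n w).1 =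
    mfderiv 𝓘(ℝ, E) 𝓘(ℝ, EP) a n w := congrArg Prod.fst h4
  have h6 : (mfderiv 𝓘(ℝ, E) (𝓘(ℝ, EP).prod 𝓘(ℝ, EG)) (fun x => (a x, b x)) n w).2 =
    mfderiv 𝓘(ℝ, E) 𝓘(ℝ, EG) b n w := congrArg Prod.snd h4
  exact congrArg₂ (· + ·) (congrArg _ h5) (congrArg _ h6)

/-- In a trivialisation, `s` is the section at the identity of `G` and `γ` the group coordinate. -/
theorem exists_local_section (x : M) :
    ∃ (U : Set M) (s : M → P) (γ : P → G), IsOpen U ∧ x ∈ U ∧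
      ContMDiffOn 𝓘(ℝ, EM) 𝓘(ℝ, EP) ∞ s U ∧
      ContMDiffOn 𝓘(ℝ, EP) 𝓘(ℝ, EG) ∞ γ (B.proj ⁻¹' U) ∧
      ∀ q ∈ B.proj ⁻¹' U, B.act (s (B.proj q)) (γ q) = q := by
  obtain ⟨U, hU, hxU, φ, hsrc, htgt, hφ⟩ := B.locally_trivial x
  refine ⟨U, fun u => φ (u, 1), fun q => (φ.symm q).2, hU, hxU, ?_, ?_, ?_⟩
  · refine φ.contMDiffOn.comp (contMDiff_id.prodMk contMDiff_const).contMDiffOn fun u hu => ?_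
    rw [hsrc]
    exact ⟨hu, mem_univ _⟩
  · rw [← htgt]
    exact contMDiff_snd.comp_contMDiffOn φ.symm.contMDiffOn
  · intro q hq
    rw [← htgt] at hq
    have hs : φ.symm q ∈ φ.source := φ.map_target hq
    have hr : φ (φ.symm q) = q := φ.right_inv hq
    rw [hsrc] at hs
    have hp : B.proj q = (φ.symm q).1 := by
      conv_lhs => rw [← hr]
      exact (hφ _ hs.1 (φ.symm q).2 1).1
    rw [hp, (hφ _ hs.1 1 (φ.symm q).2).2, one_mul]
    exact hr

/-- Differentiate p x = (p g)(g⁻¹ x) at x = g: the velocity along an orbit becomes a fundamental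
vector at p g. -/
theorem mfderiv_act_right_eq [LieGroup 𝓘(ℝ, EG) ∞ G] (p : P) (g : G)
    (w : TangentSpace 𝓘(ℝ, EG) g) :
    (mfderiv 𝓘(ℝ, EG) 𝓘(ℝ, EP) (B.act p) g w : EP) =
      mfderiv 𝓘(ℝ, EG) 𝓘(ℝ, EP) (B.act (B.act p g)) 1
        (mfderiv 𝓘(ℝ, EG) 𝓘(ℝ, EG) (fun x : G => g⁻¹ * x) g w : EG) := by
  have hfun : B.act p = B.act (B.act p g) ∘ (fun x : G => g⁻¹ * x) := by
    ext x
    simp [← B.act_mul]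
  have hcongr : ∀ x : G, x = 1 → ∀ u : EG,
      (mfderiv 𝓘(ℝ, EG) 𝓘(ℝ, EP) (B.act (B.act p g)) x u : EP) =
        mfderiv 𝓘(ℝ, EG) 𝓘(ℝ, EP) (B.act (B.act p g)) 1 u := by
    rintro _ rfl _; rfl
  have h1 := mfderiv_comp (I := 𝓘(ℝ, EG)) (I' := 𝓘(ℝ, EG)) (I'' := 𝓘(ℝ, EP)) g
    (g := B.act (B.act p g)) (f := fun x : G => g⁻¹ * x)
    ((B.contMDiff_act_right _).contMDiffAt.mdifferentiableAt (by simp))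
    ((contMDiff_mul_left (I := 𝓘(ℝ, EG)) (n := ∞)).contMDiffAt.mdifferentiableAt (by simp))
  rw [← hfun] at h1
  exact (congrArg (fun L => L w) h1).trans (hcongr _ (inv_mul_cancel g) _)

end PrincipalBundle

namespace ConnectionForm

variable [IsManifold 𝓘(ℝ, EP) 1 P] {B : PrincipalBundle EG EP EM G P M} (A : ConnectionForm B)

theorem form_mfderiv_act_one (p : P) (Y : GroupLieAlgebra 𝓘(ℝ, EG) G) :
    A.form p (mfderiv 𝓘(ℝ, EG) 𝓘(ℝ, EP) (B.act p) 1 Y : EP) = Y := by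
  have hcongr : ∀ q : P, q = p → ∀ w : EP, A.form q w = A.form p w := by
    rintro _ rfl _; rfl
  exact (hcongr _ (B.act_one p) _).symm.trans (A.form_fundamental p Y)

/-- On each orbit the connection restricts to the left Maurer–Cartan form, so the value does not
depend on `p`. -/
theorem form_mfderiv_act [LieGroup 𝓘(ℝ, EG) ∞ G] (p : P) (g : G) (w : TangentSpace 𝓘(ℝ, EG) g) :
    (A.form (B.act p g) (mfderiv 𝓘(ℝ, EG) 𝓘(ℝ, EP) (B.act p) g w) : EG) =
      mfderiv 𝓘(ℝ, EG) 𝓘(ℝ, EG) (fun x : G => g⁻¹ * x) g w :=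
  (congrArg (A.form (B.act p g)) (B.mfderiv_act_right_eq p g w)).trans
    (A.form_mfderiv_act_one _ _)

theorem form_act_eq_zero {p : P} {X : TangentSpace 𝓘(ℝ, EP) p} (hX : A.form p X = 0) (g : G) :
    A.form (B.act p g) (mfderiv 𝓘(ℝ, EP) 𝓘(ℝ, EP) (fun q => B.act q g) p X) = 0 := by
  rw [A.form_act, hX]
  exact map_zero (mfderiv 𝓘(ℝ, EG) 𝓘(ℝ, EG) (fun x : G => g⁻¹ * x * g⁻¹⁻¹) 1)

end ConnectionForm

end PrincipalBundles

/-! ### Vertical vectors, and the vanishing of dA on a horizontal and a vertical vector -/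

/-- Constancy along one line suffices: where `f` is not differentiable, `fderiv` has the default
value 0. -/
theorem fderiv_apply_eq_zero_of_eventually_eq {W F : Type*} [NormedAddCommGroup W]
    [NormedSpace ℝ W] [NormedAddCommGroup F] [NormedSpace ℝ F] {f : W → F} {x a : W} {y : F}
    (h : ∀ᶠ t : ℝ in 𝓝 0, f (x + t • a) = y) : fderiv ℝ f x a = 0 := by
  by_cases hf : DifferentiableAt ℝ f x
  · rw [← hf.lineDeriv_eq_fderiv]
    have h1 : (fun t : ℝ => f (x + t • a)) =ᶠ[𝓝 0] fun _ => y := h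
    rw [lineDeriv, h1.deriv_eq, deriv_const]
  · rw [fderiv_zero_of_not_differentiableAt hf]
    simp

/-- The curve is a straight line in the chart at `p`. -/
theorem exists_curve_of_tangentVector {E : Type*} [NormedAddCommGroup E] [NormedSpace ℝ E]
    {X : Type*} [TopologicalSpace X] [ChartedSpace E X] [IsManifold 𝓘(ℝ, E) ∞ X] (p : X) (v : E) :
    ∃ α : ℝ → X, ContMDiffAt 𝓘(ℝ, ℝ) 𝓘(ℝ, E) ∞ α 0 ∧ α 0 = p ∧
      (mfderiv 𝓘(ℝ, ℝ) 𝓘(ℝ, E) α 0 (1 : ℝ) : E) = v := by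
  set ψ := extChartAt 𝓘(ℝ, E) p with hψ
  set u : E := mfderiv 𝓘(ℝ, E) 𝓘(ℝ, E) ψ p v with hu
  set l : ℝ → E := fun t => ψ p + t • u with hl
  have hl0 : l 0 = ψ p := by simp [hl]
  have hld : HasDerivAt l u 0 := by
    simpa [hl] using ((hasDerivAt_id (0 : ℝ)).smul_const u).const_add (ψ p)
  have hls : ContMDiffAt 𝓘(ℝ, ℝ) 𝓘(ℝ, E) ∞ l 0 :=
    (contDiff_const.add (contDiff_id.smul contDiff_const)).contDiffAt.contMDiffAt
  have hsymm : ContMDiffAt 𝓘(ℝ, E) 𝓘(ℝ, E) ∞ ψ.symm (l 0) := by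
    rw [hl0]
    exact (contMDiffOn_extChartAt_symm p).contMDiffAt (extChartAt_target_mem_nhds p)
  refine ⟨ψ.symm ∘ l, hsymm.comp 0 hls, ?_, ?_⟩
  · rw [Function.comp_apply, hl0]
    exact extChartAt_to_inv p
  · have h1 := mfderiv_comp (I := 𝓘(ℝ, ℝ)) (I' := 𝓘(ℝ, E)) (I'' := 𝓘(ℝ, E)) 0
      (hsymm.mdifferentiableAt (by simp)) (hls.mdifferentiableAt (by simp))
    have h2 : (mfderiv 𝓘(ℝ, ℝ) 𝓘(ℝ, E) l 0 (1 : ℝ) : E) = u := by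
      rw [mfderiv_eq_fderiv]
      exact hld.deriv
    have h3 : ∀ y : E, y = ψ p → (mfderiv 𝓘(ℝ, E) 𝓘(ℝ, E) ψ.symm y u : E) = v := by
      rintro _ rfl
      exact mfderiv_extChartAt_symm_apply_mfderiv_extChartAt (mem_extChartAt_source p) v
    exact (congrArg (fun L => L (1 : ℝ)) h1).trans
      ((congrArg (mfderiv 𝓘(ℝ, E) 𝓘(ℝ, E) ψ.symm (l 0)) h2).trans (h3 _ hl0))

section PrincipalBundles

variable {EG : Type*} [NormedAddCommGroup EG] [NormedSpace ℝ EG]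
  {EP : Type*} [NormedAddCommGroup EP] [NormedSpace ℝ EP]
  {EM : Type*} [NormedAddCommGroup EM] [NormedSpace ℝ EM]
  {G : Type*} [TopologicalSpace G] [ChartedSpace EG G] [Group G]
  {P : Type*} [TopologicalSpace P] [ChartedSpace EP P]
  {M : Type*} [TopologicalSpace M] [ChartedSpace EM M]

/-- Differentiate q = s(π q) γ(q) at `p` in the direction `w`. The factor s(π q) contributes nothing
because `w` is vertical, so only the derivative of an orbit map remains. -/
theorem PrincipalBundle.exists_eq_mfderiv_act_of_mfderiv_proj_eq_zero [LieGroup 𝓘(ℝ, EG) ∞ G]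
    (B : PrincipalBundle EG EP EM G P M) {p : P} {w : TangentSpace 𝓘(ℝ, EP) p}
    (hw : (mfderiv 𝓘(ℝ, EP) 𝓘(ℝ, EM) B.proj p w : EM) = 0) :
    ∃ Y : EG, (mfderiv 𝓘(ℝ, EG) 𝓘(ℝ, EP) (B.act p) 1 Y : EP) = w := by
  obtain ⟨U, s, γ, hU, hxU, hs, hγ, hsγ⟩ := B.exists_local_section (B.proj p)
  have hproj : MDifferentiableAt 𝓘(ℝ, EP) 𝓘(ℝ, EM) B.proj p :=
    B.contMDiff_proj.contMDiffAt.mdifferentiableAt (by simp)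
  have hpre : B.proj ⁻¹' U ∈ 𝓝 p :=
    B.contMDiff_proj.continuous.continuousAt.preimage_mem_nhds (hU.mem_nhds hxU)
  have hsd : MDifferentiableAt 𝓘(ℝ, EM) 𝓘(ℝ, EP) s (B.proj p) :=
    (hs.contMDiffAt (hU.mem_nhds hxU)).mdifferentiableAt (by simp)
  have hγd : MDifferentiableAt 𝓘(ℝ, EP) 𝓘(ℝ, EG) γ p :=
    (hγ.contMDiffAt hpre).mdifferentiableAt (by simp)
  have h1 := B.mfderiv_act_comp (a := s ∘ B.proj) (b := γ) (hsd.comp p hproj) hγd w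
  have h2 : (fun q => B.act ((s ∘ B.proj) q) (γ q)) =ᶠ[𝓝 p] id := by
    filter_upwards [hpre] with q hq using hsγ q hq
  have h3 : (mfderiv 𝓘(ℝ, EP) 𝓘(ℝ, EP) (fun q => B.act ((s ∘ B.proj) q) (γ q)) p w : EP) = w := by
    have := h2.mfderiv_eq (I := 𝓘(ℝ, EP)) (I' := 𝓘(ℝ, EP))
    exact (congrArg (fun L : EP →L[ℝ] EP => L w) this).trans
      (congrArg (fun L => L w) (mfderiv_id (I := 𝓘(ℝ, EP)) (x := p)))
  have h4 : (mfderiv 𝓘(ℝ, EP) 𝓘(ℝ, EP) (s ∘ B.proj) p w : EP) = 0 :=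
    (congrArg (fun L => L w) (mfderiv_comp (I := 𝓘(ℝ, EP)) (I' := 𝓘(ℝ, EM)) (I'' := 𝓘(ℝ, EP))
      p hsd hproj)).trans ((congrArg (mfderiv 𝓘(ℝ, EM) 𝓘(ℝ, EP) s (B.proj p)) hw).trans
        (map_zero _))
  have h5 : (mfderiv 𝓘(ℝ, EP) 𝓘(ℝ, EP) (fun q => B.act q (γ p)) ((s ∘ B.proj) p)
      (mfderiv 𝓘(ℝ, EP) 𝓘(ℝ, EP) (s ∘ B.proj) p w) : EP) = 0 :=
    (congrArg (mfderiv 𝓘(ℝ, EP) 𝓘(ℝ, EP) (fun q => B.act q (γ p)) ((s ∘ B.proj) p)) h4).trans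
      (map_zero _)
  have h6 : (mfderiv 𝓘(ℝ, EG) 𝓘(ℝ, EP) (B.act ((s ∘ B.proj) p)) (γ p)
      (mfderiv 𝓘(ℝ, EP) 𝓘(ℝ, EG) γ p w) : EP) = w := by
    have aux : ∀ a b c : EP, a = 0 → c = a + b → b = c := by
      rintro _ b c rfl hc
      rw [hc, zero_add]
    exact aux _ _ _ h5 (h3.symm.trans h1)
  have h7 := (B.mfderiv_act_right_eq _ _ (mfderiv 𝓘(ℝ, EP) 𝓘(ℝ, EG) γ p w)).symm.trans h6
  have h8 : B.act ((s ∘ B.proj) p) (γ p) = p := hsγ p hxU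
  rw [h8] at h7
  exact ⟨_, h7⟩

namespace ConnectionForm

variable [IsManifold 𝓘(ℝ, EP) ∞ P]
  {B : PrincipalBundle EG EP EM G P M} (A : ConnectionForm B)

/-- The difference is vertical, hence the fundamental vector of some `Y`; the connection recovers
`Y` from it, so `Y = 0`. -/
theorem eq_of_form_eq_of_mfderiv_proj_eq [LieGroup 𝓘(ℝ, EG) ∞ G] {p : P}
    {v w : TangentSpace 𝓘(ℝ, EP) p}
    (hform : A.form p v = A.form p w)
    (hproj : mfderiv 𝓘(ℝ, EP) 𝓘(ℝ, EM) B.proj p v = mfderiv 𝓘(ℝ, EP) 𝓘(ℝ, EM) B.proj p w) :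
    v = w := by
  have h1 : mfderiv 𝓘(ℝ, EP) 𝓘(ℝ, EM) B.proj p (v - w) = 0 := by
    rw [map_sub, hproj, sub_self]
  obtain ⟨Y, hY⟩ := B.exists_eq_mfderiv_act_of_mfderiv_proj_eq_zero h1
  have h2 : A.form p (v - w) = 0 := by rw [map_sub, hform, sub_self]
  have h3 : Y = 0 := (A.form_mfderiv_act_one p Y).symm.trans ((congrArg (A.form p) hY).trans h2)
  have h4 : v - w = 0 := hY.symm.trans
    ((congrArg (mfderiv 𝓘(ℝ, EG) 𝓘(ℝ, EP) (B.act p) 1) h3).trans (map_zero _))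
  exact sub_eq_zero.1 h4

/-- The exterior derivative of a connection form vanishes on a horizontal and a vertical vector. -/
theorem extDerivForm_eq_zero [FiniteDimensional ℝ EP] [LieGroup 𝓘(ℝ, EG) ∞ G] {p : P}
    {X w : TangentSpace 𝓘(ℝ, EP) p} (hX : A.form p X = 0)
    (hw : mfderiv 𝓘(ℝ, EP) 𝓘(ℝ, EM) B.proj p w = 0) :
    extDerivOneForm (F := EG) A.form p X w = 0 := by
  obtain ⟨Y, hY⟩ := B.exists_eq_mfderiv_act_of_mfderiv_proj_eq_zero hw
  obtain ⟨α, hα, hα0, hαX⟩ := exists_curve_of_tangentVector (E := EP) p X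
  obtain ⟨β, hβ, hβ0, hβY⟩ := exists_curve_of_tangentVector (E := EG) (1 : G) Y
  subst hα0
  -- The surface α(s) β(t) has partial derivatives `X` and `w` at the origin, so dA(X, w) = ∂ₛ A(∂ₜ
  -- f) - ∂ₜ A(∂ₛ f) there.
  set f : ℝ × ℝ → P := fun z => B.act (α z.1) (β z.2) with hf
  have hαd : ∀ᶠ s in 𝓝 (0 : ℝ), MDifferentiableAt 𝓘(ℝ, ℝ) 𝓘(ℝ, EP) α s := by
    have h1 := hα.of_le (m := 1) (by simp)
    have : IsManifold 𝓘(ℝ, EP) 1 P := inferInstance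
    filter_upwards [(contMDiffAt_iff_contMDiffAt_nhds (by simp)).1 h1] with y hy
    exact hy.mdifferentiableAt (by simp)
  have hβd : ∀ᶠ s in 𝓝 (0 : ℝ), MDifferentiableAt 𝓘(ℝ, ℝ) 𝓘(ℝ, EG) β s := by
    have h1 := hβ.of_le (m := 1) (by simp)
    have : IsManifold 𝓘(ℝ, EG) 1 G := IsManifold.of_le (n := ∞) (by simp)
    filter_upwards [(contMDiffAt_iff_contMDiffAt_nhds (by simp)).1 h1] with y hy
    exact hy.mdifferentiableAt (by simp)
  have hfs : ContMDiffAt 𝓘(ℝ, ℝ × ℝ) 𝓘(ℝ, EP) 2 f (0, 0) := by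
    have h1 : ContMDiffAt 𝓘(ℝ, ℝ × ℝ) 𝓘(ℝ, EP) ∞ (fun z : ℝ × ℝ => α z.1) (0, 0) :=
      ContMDiffAt.comp (g := α) (0, 0) hα contDiff_fst.contDiffAt.contMDiffAt
    have h2 : ContMDiffAt 𝓘(ℝ, ℝ × ℝ) 𝓘(ℝ, EG) ∞ (fun z : ℝ × ℝ => β z.2) (0, 0) :=
      ContMDiffAt.comp (g := β) (0, 0) hβ contDiff_snd.contDiffAt.contMDiffAt
    exact (B.contMDiff_act.contMDiffAt.comp (0, 0) (h1.prodMk h2)).of_le ENat.LEInfty.out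
  have hDf : ∀ s t : ℝ, MDifferentiableAt 𝓘(ℝ, ℝ) 𝓘(ℝ, EP) α s →
      MDifferentiableAt 𝓘(ℝ, ℝ) 𝓘(ℝ, EG) β t → ∀ a b : ℝ,
      (mfderiv 𝓘(ℝ, ℝ × ℝ) 𝓘(ℝ, EP) f (s, t) (a, b) : EP) =
        (mfderiv 𝓘(ℝ, EP) 𝓘(ℝ, EP) (fun q => B.act q (β t)) (α s)
          (mfderiv 𝓘(ℝ, ℝ) 𝓘(ℝ, EP) α s a) : EP) +
        (mfderiv 𝓘(ℝ, EG) 𝓘(ℝ, EP) (B.act (α s)) (β t) (mfderiv 𝓘(ℝ, ℝ) 𝓘(ℝ, EG) β t b) : EP) := by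
    intro s t hs ht a b
    have e1 : MDifferentiableAt 𝓘(ℝ, ℝ × ℝ) 𝓘(ℝ, ℝ) (Prod.fst : ℝ × ℝ → ℝ) (s, t) :=
      differentiableAt_fst.mdifferentiableAt
    have e2 : MDifferentiableAt 𝓘(ℝ, ℝ × ℝ) 𝓘(ℝ, ℝ) (Prod.snd : ℝ × ℝ → ℝ) (s, t) :=
      differentiableAt_snd.mdifferentiableAt
    have h1 := mfderiv_comp (I := 𝓘(ℝ, ℝ × ℝ)) (I' := 𝓘(ℝ, ℝ)) (I'' := 𝓘(ℝ, EP)) (s, t)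
      (g := α) (f := Prod.fst) hs e1
    have h2 := mfderiv_comp (I := 𝓘(ℝ, ℝ × ℝ)) (I' := 𝓘(ℝ, ℝ)) (I'' := 𝓘(ℝ, EG)) (s, t)
      (g := β) (f := Prod.snd) ht e2
    rw [mfderiv_eq_fderiv, fderiv_fst] at h1
    rw [mfderiv_eq_fderiv, fderiv_snd] at h2
    have h3 := congrArg (fun L => L (a, b)) h1
    have h4 := congrArg (fun L => L (a, b)) h2
    have h5 := B.mfderiv_act_comp (n := (s, t)) (a := α ∘ Prod.fst) (b := β ∘ Prod.snd)
      (MDifferentiableAt.comp (s, t) hs e1) (MDifferentiableAt.comp (s, t) ht e2) (a, b)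
    exact h5.trans (congrArg₂ (fun u v : EP => u + v)
      (congrArg (mfderiv 𝓘(ℝ, EP) 𝓘(ℝ, EP) (fun q => B.act q (β t)) (α s)) h3)
      (congrArg (mfderiv 𝓘(ℝ, EG) 𝓘(ℝ, EP) (B.act (α s)) (β t)) h4))
  have hDf1 : ∀ s t : ℝ, MDifferentiableAt 𝓘(ℝ, ℝ) 𝓘(ℝ, EP) α s →
      MDifferentiableAt 𝓘(ℝ, ℝ) 𝓘(ℝ, EG) β t →
      (mfderiv 𝓘(ℝ, ℝ × ℝ) 𝓘(ℝ, EP) f (s, t) ((1 : ℝ), (0 : ℝ)) : EP) =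
        (mfderiv 𝓘(ℝ, EP) 𝓘(ℝ, EP) (fun q => B.act q (β t)) (α s)
          (mfderiv 𝓘(ℝ, ℝ) 𝓘(ℝ, EP) α s (1 : ℝ)) : EP) := fun s t hs ht =>
    (hDf s t hs ht 1 0).trans ((congrArg _ ((congrArg
      (mfderiv 𝓘(ℝ, EG) 𝓘(ℝ, EP) (B.act (α s)) (β t)) (map_zero _)).trans (map_zero _))).trans
        (add_zero _))
  have zero_add_aux : ∀ a b c : EP, a = 0 → c = a + b → c = b := by
    rintro _ b c rfl hc
    rw [hc, zero_add]
  have hDf2 : ∀ s t : ℝ, MDifferentiableAt 𝓘(ℝ, ℝ) 𝓘(ℝ, EP) α s →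
      MDifferentiableAt 𝓘(ℝ, ℝ) 𝓘(ℝ, EG) β t →
      (mfderiv 𝓘(ℝ, ℝ × ℝ) 𝓘(ℝ, EP) f (s, t) ((0 : ℝ), (1 : ℝ)) : EP) =
        (mfderiv 𝓘(ℝ, EG) 𝓘(ℝ, EP) (B.act (α s)) (β t)
          (mfderiv 𝓘(ℝ, ℝ) 𝓘(ℝ, EG) β t (1 : ℝ)) : EP) := fun s t hs ht =>
    zero_add_aux _ _ _ ((congrArg
      (mfderiv 𝓘(ℝ, EP) 𝓘(ℝ, EP) (fun q => B.act q (β t)) (α s)) (map_zero _)).trans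
        (map_zero _)) (hDf s t hs ht 0 1)
  have key := extDerivOneForm_pullback (F := EG) A.contMDiff_form hfs
    ((1 : ℝ), (0 : ℝ)) ((0 : ℝ), (1 : ℝ))
  -- Along t = 0, A(∂ₜ f) is the Maurer–Cartan form on β'(0), whatever the value of s.
  have z1 : fderiv ℝ (fun y => (A.form (f y)
      (mfderiv 𝓘(ℝ, ℝ × ℝ) 𝓘(ℝ, EP) f y ((0 : ℝ), (1 : ℝ))) : EG)) (0, 0)
        ((1 : ℝ), (0 : ℝ)) = 0 := by
    apply fderiv_apply_eq_zero_of_eventually_eq (F := EG)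
      (y := mfderiv 𝓘(ℝ, EG) 𝓘(ℝ, EG) (fun x : G => (β 0)⁻¹ * x) (β 0)
        (mfderiv 𝓘(ℝ, ℝ) 𝓘(ℝ, EG) β 0 (1 : ℝ)))
    filter_upwards [hαd] with t ht
    have e : ((0 : ℝ), (0 : ℝ)) + t • ((1 : ℝ), (0 : ℝ)) = (t, 0) := by simp
    rw [e]
    exact (congrArg (A.form (f (t, 0))) (hDf2 t 0 ht hβd.self_of_nhds)).trans
      (A.form_mfderiv_act (α t) (β 0) _)
  -- Along s = 0, ∂ₛ f is a right translate of the horizontal vector `X`.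
  have z2 : fderiv ℝ (fun y => (A.form (f y)
      (mfderiv 𝓘(ℝ, ℝ × ℝ) 𝓘(ℝ, EP) f y ((1 : ℝ), (0 : ℝ))) : EG)) (0, 0)
        ((0 : ℝ), (1 : ℝ)) = 0 := by
    apply fderiv_apply_eq_zero_of_eventually_eq (F := EG) (y := 0)
    filter_upwards [hβd] with t ht
    have e : ((0 : ℝ), (0 : ℝ)) + t • ((0 : ℝ), (1 : ℝ)) = (0, t) := by simp
    rw [e]
    exact (congrArg (A.form (f (0, t))) (hDf1 0 t hαd.self_of_nhds ht)).trans
      (A.form_act_eq_zero ((congrArg (A.form (α 0)) hαX).trans hX) (β t))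
  have hf0 : f (0, 0) = α 0 := by simp [hf, hβ0, B.act_one]
  have hcongr : ∀ q : P, q = α 0 → ∀ u v : EP,
      extDerivOneForm (F := EG) A.form q u v = extDerivOneForm (F := EG) A.form (α 0) u v := by
    rintro _ rfl _ _; rfl
  have hX' : (mfderiv 𝓘(ℝ, ℝ × ℝ) 𝓘(ℝ, EP) f (0, 0) ((1 : ℝ), (0 : ℝ)) : EP) = X := by
    have h1 : ∀ g : G, g = 1 → ∀ u : EP,
        (mfderiv 𝓘(ℝ, EP) 𝓘(ℝ, EP) (fun q => B.act q g) (α 0) u : EP) = u := by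
      rintro _ rfl u
      have : (fun q => B.act q 1) = id := funext B.act_one
      rw [this, mfderiv_id]
      rfl
    exact (hDf1 0 0 hαd.self_of_nhds hβd.self_of_nhds).trans ((h1 _ hβ0 _).trans hαX)
  have hw' : (mfderiv 𝓘(ℝ, ℝ × ℝ) 𝓘(ℝ, EP) f (0, 0) ((0 : ℝ), (1 : ℝ)) : EP) = w := by
    have h1 : ∀ g : G, g = 1 → ∀ u : EG,
        (mfderiv 𝓘(ℝ, EG) 𝓘(ℝ, EP) (B.act (α 0)) g u : EP) =
          mfderiv 𝓘(ℝ, EG) 𝓘(ℝ, EP) (B.act (α 0)) 1 u := by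
      rintro _ rfl _; rfl
    exact (hDf2 0 0 hαd.self_of_nhds hβd.self_of_nhds).trans ((h1 _ hβ0 _).trans
      ((congrArg (mfderiv 𝓘(ℝ, EG) 𝓘(ℝ, EP) (B.act (α 0)) 1) hβY).trans hY))
  have h0 : extDerivOneForm (F := EG) A.form (f (0, 0))
      (mfderiv 𝓘(ℝ, ℝ × ℝ) 𝓘(ℝ, EP) f (0, 0) ((1 : ℝ), (0 : ℝ)))
      (mfderiv 𝓘(ℝ, ℝ × ℝ) 𝓘(ℝ, EP) f (0, 0) ((0 : ℝ), (1 : ℝ))) = 0 :=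
    key.trans ((congrArg₂ (fun a b : EG => a - b) z1 z2).trans (sub_zero _))
  exact (congrArg₂ (fun u v : EP => extDerivOneForm (F := EG) A.form (α 0) u v) hX' hw').symm.trans
    ((hcongr _ hf0 _ _).symm.trans h0)

/-- The curvature reduces to the exterior derivative if the first vector is horizontal. -/
theorem curvature_of_horizontal {p : P} {X w : TangentSpace 𝓘(ℝ, EP) p} (hX : A.form p X = 0) :
    A.curvature p X w = extDerivOneForm (F := EG) A.form p X w := by
  have h0 : ∀ Y : GroupLieAlgebra 𝓘(ℝ, EG) G,
      ⁅(0 : GroupLieAlgebra 𝓘(ℝ, EG) G), Y⁆ - ⁅Y, (0 : GroupLieAlgebra 𝓘(ℝ, EG) G)⁆ = 0 := by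
    intro Y
    have hz : mulInvariantVectorField (I := 𝓘(ℝ, EG)) (0 : GroupLieAlgebra 𝓘(ℝ, EG) G) = 0 := by
      ext g
      exact map_zero _
    rw [GroupLieAlgebra.bracket_def, GroupLieAlgebra.bracket_def, hz]
    simp
  have h1 : A.bracketForm p X w = 0 := by
    unfold bracketForm
    rw [hX]
    exact h0 _
  unfold curvature
  rw [h1, smul_zero, add_zero]
  rfl

end ConnectionForm

end PrincipalBundles

/-! ### Uniqueness of horizontal lifts and of tangent fields along them -/

/-- The fundamental theorem of calculus tolerates a countable exceptional set; here that set
consists of break points. -/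
theorem eq_of_hasDerivAt_zero_off_countable {F : Type*} [NormedAddCommGroup F] [NormedSpace ℝ F]
    [CompleteSpace F] {f : ℝ → F} {a b : ℝ} (hab : a ≤ b) {s : Set ℝ} (hs : s.Countable)
    (hf : ContinuousOn f (Icc a b)) (hd : ∀ x ∈ Ioo a b \ s, HasDerivAt f 0 x) : f b = f a := by
  have h := MeasureTheory.integral_eq_of_hasDerivAt_off_countable_of_le f (fun _ => 0) hab hs hf hd
    (intervalIntegrable_const)
  rw [intervalIntegral.integral_zero] at h
  exact sub_eq_zero.1 h.symm

section PrincipalBundles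

variable {EG : Type*} [NormedAddCommGroup EG] [NormedSpace ℝ EG]
  {EP : Type*} [NormedAddCommGroup EP] [NormedSpace ℝ EP]
  {EM : Type*} [NormedAddCommGroup EM] [NormedSpace ℝ EM]
  {G : Type*} [TopologicalSpace G] [ChartedSpace EG G] [Group G]
  {P : Type*} [TopologicalSpace P] [ChartedSpace EP P]
  {M : Type*} [TopologicalSpace M] [ChartedSpace EM M]

namespace ConnectionForm

variable [IsManifold 𝓘(ℝ, EP) 1 P] [LieGroup 𝓘(ℝ, EG) ∞ G]
  {B : PrincipalBundle EG EP EM G P M} (A : ConnectionForm B)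

/-- Two horizontal curves which differ by a curve in the group differ by a stationary one. -/
theorem mfderiv_eq_zero_of_horizontal {c₁ c₂ : ℝ → P} {h : ℝ → G} {u : ℝ}
    (hc₁ : MDifferentiableAt 𝓘(ℝ, ℝ) 𝓘(ℝ, EP) c₁ u) (hh : MDifferentiableAt 𝓘(ℝ, ℝ) 𝓘(ℝ, EG) h u)
    (heq : c₂ =ᶠ[𝓝 u] fun x => B.act (c₁ x) (h x))
    (h₁ : A.form (c₁ u) (mfderiv 𝓘(ℝ, ℝ) 𝓘(ℝ, EP) c₁ u (1 : ℝ)) = 0)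
    (h₂ : A.form (c₂ u) (mfderiv 𝓘(ℝ, ℝ) 𝓘(ℝ, EP) c₂ u (1 : ℝ)) = 0) :
    (mfderiv 𝓘(ℝ, ℝ) 𝓘(ℝ, EG) h u (1 : ℝ) : EG) = 0 := by
  have e1 := B.mfderiv_act_comp hc₁ hh (1 : ℝ)
  have e2 : (mfderiv 𝓘(ℝ, ℝ) 𝓘(ℝ, EP) c₂ u (1 : ℝ) : EP) =
      mfderiv 𝓘(ℝ, ℝ) 𝓘(ℝ, EP) (fun x => B.act (c₁ x) (h x)) u (1 : ℝ) :=
    congrArg (fun L : ℝ →L[ℝ] EP => L 1) (heq.mfderiv_eq (I := 𝓘(ℝ, ℝ)) (I' := 𝓘(ℝ, EP)))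
  have hcongr : ∀ q : P, c₂ u = q → ∀ w : EP, A.form (c₂ u) w = A.form q w := by
    rintro _ rfl _; rfl
  have e3 : A.form (B.act (c₁ u) (h u))
      (mfderiv 𝓘(ℝ, ℝ) 𝓘(ℝ, EP) (fun x => B.act (c₁ x) (h x)) u (1 : ℝ)) = 0 :=
    (hcongr _ heq.self_of_nhds _).symm.trans ((congrArg (A.form (c₂ u)) e2).symm.trans h₂)
  have e4 := (congrArg (A.form (B.act (c₁ u) (h u))) e1).symm.trans e3
  -- In the Leibniz rule the translate of the velocity of `c₁` is horizontal; what is left is the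
  -- Maurer–Cartan form on the velocity of `h`.
  rw [map_add, A.form_act_eq_zero h₁, zero_add] at e4
  exact eq_zero_of_mfderiv_mul_left_eq_zero ((A.form_mfderiv_act _ _ _).symm.trans e4)

/-- Uniqueness of horizontal lifts. -/
theorem eqOn_of_horizontal [FiniteDimensional ℝ EG] [T2Space P] {c₁ c₂ : ℝ → P} {a b : ℝ}
    {s : Set ℝ} (hs : s.Countable)
    (hc₁ : ContinuousOn c₁ (Icc a b)) (hc₂ : ContinuousOn c₂ (Icc a b))
    (h₁ : ∀ u ∈ Ioo a b \ s, MDifferentiableAt 𝓘(ℝ, ℝ) 𝓘(ℝ, EP) c₁ u ∧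
      A.form (c₁ u) (mfderiv 𝓘(ℝ, ℝ) 𝓘(ℝ, EP) c₁ u (1 : ℝ)) = 0)
    (h₂ : ∀ u ∈ Ioo a b \ s, MDifferentiableAt 𝓘(ℝ, ℝ) 𝓘(ℝ, EP) c₂ u ∧
      A.form (c₂ u) (mfderiv 𝓘(ℝ, ℝ) 𝓘(ℝ, EP) c₂ u (1 : ℝ)) = 0)
    (hproj : ∀ u ∈ Icc a b, B.proj (c₁ u) = B.proj (c₂ u)) (ha : c₁ a = c₂ a) :
    ∀ u ∈ Icc a b, c₁ u = c₂ u := by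
  have : CompleteSpace EG := FiniteDimensional.complete ℝ EG
  have hG1 : IsManifold 𝓘(ℝ, EG) 1 G := IsManifold.of_le (n := ∞) (by simp)
  have hGd : ContMDiff (𝓘(ℝ, EG).prod 𝓘(ℝ, EG)) 𝓘(ℝ, EG) ∞ (fun p : G × G => p.1⁻¹ * p.2) :=
    contMDiff_fst.inv.mul contMDiff_snd
  have hclosed : IsClosed ({u | c₁ u = c₂ u} ∩ Icc a b) := by
    rw [inter_comm]
    exact (hc₁.prodMk hc₂).preimage_isClosed_of_isClosed isClosed_Icc isClosed_diagonal
  -- The coincidence set is closed and contains `a`; it remains to continue it a little to the right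
  -- of each of its points.
  refine hclosed.Icc_subset_of_forall_mem_nhdsWithin ha ?_
  rintro x ⟨hx, hxab⟩
  obtain ⟨U, σ, γ, hU, hxU, -, hγ, hσγ⟩ := B.exists_local_section (B.proj (c₁ x))
  have hV : IsOpen (B.proj ⁻¹' U) := hU.preimage B.contMDiff_proj.continuous
  -- Both lifts have the same projection, hence the same value of the section, so `c₂` is `c₁` acted
  -- on by the quotient of the group coordinates.
  set h : ℝ → G := fun u => (γ (c₁ u))⁻¹ * γ (c₂ u) with hh
  have hx1 : h x = 1 := by simp [hh, show c₁ x = c₂ x from hx]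
  have hcts : ∀ u ∈ Icc a b, c₁ u ∈ B.proj ⁻¹' U → c₂ u ∈ B.proj ⁻¹' U →
      ContinuousWithinAt h (Icc a b) u := by
    intro u hu hu1 hu2
    have g1 := ((hγ.contMDiffAt (hV.mem_nhds hu1)).continuousAt).comp_continuousWithinAt (hc₁ u hu)
    have g2 := ((hγ.contMDiffAt (hV.mem_nhds hu2)).continuousAt).comp_continuousWithinAt (hc₂ u hu)
    exact hGd.continuous.continuousAt.comp_continuousWithinAt (g1.prodMk g2)
  have hxI : x ∈ Icc a b := Ico_subset_Icc_self hxab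
  have hx2U : c₂ x ∈ B.proj ⁻¹' U := by
    rw [mem_preimage, ← hproj x hxI]; exact hxU
  have hev : ∀ᶠ u in 𝓝[Icc a b] x, c₁ u ∈ B.proj ⁻¹' U ∧ c₂ u ∈ B.proj ⁻¹' U ∧
      h u ∈ (extChartAt 𝓘(ℝ, EG) (1 : G)).source := by
    refine ((hc₁ x hxI).eventually (hV.mem_nhds hxU)).and
      (((hc₂ x hxI).eventually (hV.mem_nhds hx2U)).and
        ((hcts x hxI hxU hx2U).eventually ?_))
    rw [hx1]
    exact extChartAt_source_mem_nhds (I := 𝓘(ℝ, EG)) (1 : G)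
  have hGE : 𝓝[≥] x ≤ 𝓝[Icc a b] x := by
    rw [← nhdsWithin_Icc_eq_nhdsGE hxab.2]
    exact nhdsWithin_mono x (Icc_subset_Icc_left hxab.1)
  -- On [x, e] both paths stay over the trivialising set and `h` stays in the chart at 1, where
  -- constancy can be tested in coordinates.
  obtain ⟨e, hxe, he⟩ := mem_nhdsGE_iff_exists_Icc_subset.1
    (Filter.inter_mem (hGE hev) (hGE self_mem_nhdsWithin))
  have hxe' : x < e := hxe
  suffices hall : ∀ y ∈ Icc x e, c₁ y = c₂ y by
    filter_upwards [Icc_mem_nhdsGT hxe'] with y hy using hall y hy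
  intro y hy
  have hkd : ∀ u ∈ Ioo x y \ s, HasDerivAt (fun z => extChartAt 𝓘(ℝ, EG) (1 : G) (h z)) 0 u := by
    rintro u ⟨hu, hus⟩
    have hue : u ∈ Ioo x e := ⟨hu.1, hu.2.trans_le hy.2⟩
    have hunhds : Ioo x e ∈ 𝓝 u := Ioo_mem_nhds hue.1 hue.2
    have hxab' := (he (left_mem_Icc.2 hxe'.le)).2
    have heab := (he (right_mem_Icc.2 hxe'.le)).2
    have huab : u ∈ Ioo a b := ⟨hxab'.1.trans_lt hue.1, hue.2.trans_le heab.2⟩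
    obtain ⟨hd₁, hA₁⟩ := h₁ u ⟨huab, hus⟩
    obtain ⟨hd₂, hA₂⟩ := h₂ u ⟨huab, hus⟩
    obtain ⟨⟨hu1, hu2, hu3⟩, -⟩ := he (Ioo_subset_Icc_self hue)
    have g1 := ((hγ.contMDiffAt (hV.mem_nhds hu1)).mdifferentiableAt (by simp)).comp u hd₁
    have g2 := ((hγ.contMDiffAt (hV.mem_nhds hu2)).mdifferentiableAt (by simp)).comp u hd₂
    have hhd : MDifferentiableAt 𝓘(ℝ, ℝ) 𝓘(ℝ, EG) h u :=
      (hGd.contMDiffAt.mdifferentiableAt (by simp)).comp u (g1.prodMk g2)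
    have heq : c₂ =ᶠ[𝓝 u] fun z => B.act (c₁ z) (h z) := by
      filter_upwards [hunhds] with z hz
      obtain ⟨⟨hz1, hz2, -⟩, hzab⟩ := he (Ioo_subset_Icc_self hz)
      have k1 := hσγ _ hz1
      have k2 := hσγ _ hz2
      rw [hproj z hzab] at k1
      conv_rhs => rw [← k1]
      rw [← B.act_mul]
      simp only [hh, mul_inv_cancel_left]
      exact k2.symm
    have hz := A.mfderiv_eq_zero_of_horizontal hd₁ hhd heq hA₁ hA₂
    have hkd' : DifferentiableAt ℝ (fun z => extChartAt 𝓘(ℝ, EG) (1 : G) (h z)) u :=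
      mdifferentiableAt_iff_differentiableAt.1 ((mdifferentiableAt_extChartAt (I := 𝓘(ℝ, EG))
        (by rwa [extChartAt_source] at hu3)).comp u hhd)
    have hk0 : deriv (fun z => extChartAt 𝓘(ℝ, EG) (1 : G) (h z)) u = 0 :=
      (fderiv_extChartAt_comp_apply hhd hu3 (1 : ℝ)).trans
        ((congrArg (mfderiv 𝓘(ℝ, EG) 𝓘(ℝ, EG) (extChartAt 𝓘(ℝ, EG) (1 : G)) (h u)) hz).trans
          (map_zero _))
    rw [← hk0]
    exact hkd'.hasDerivAt
  have hkc : ContinuousOn (fun z => extChartAt 𝓘(ℝ, EG) (1 : G) (h z)) (Icc x y) := by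
    intro u hu
    obtain ⟨⟨hu1, hu2, hu3⟩, huab⟩ := he ⟨hu.1, hu.2.trans hy.2⟩
    have hsub : Icc x y ⊆ Icc a b := fun z hz => (he ⟨hz.1, hz.2.trans hy.2⟩).2
    exact ContinuousAt.comp_continuousWithinAt (f := h) (continuousAt_extChartAt' hu3)
      ((hcts u huab hu1 hu2).mono hsub)
  have hk := eq_of_hasDerivAt_zero_off_countable hy.1 hs hkc hkd
  obtain ⟨⟨hy1, hy2, hy3⟩, hyab⟩ := he hy
  have hhy : h y = 1 := by
    rw [← hx1]
    exact (extChartAt 𝓘(ℝ, EG) (1 : G)).injOn hy3 (he (left_mem_Icc.2 hxe'.le)).1.2.2 hk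
  have hγy : γ (c₁ y) = γ (c₂ y) := inv_mul_eq_one.1 hhy
  rw [← hσγ _ hy1, ← hσγ _ hy2, hproj y hyab, hγy]

end ConnectionForm

theorem mfderiv_comp_real {c : ℝ → P} {φ : ℝ → ℝ} {u ε : ℝ}
    (hc : MDifferentiableAt 𝓘(ℝ, ℝ) 𝓘(ℝ, EP) c (φ u)) (hφ : HasDerivAt φ ε u) :
    (mfderiv 𝓘(ℝ, ℝ) 𝓘(ℝ, EP) (c ∘ φ) u (1 : ℝ) : EP) =
      ε • (mfderiv 𝓘(ℝ, ℝ) 𝓘(ℝ, EP) c (φ u) (1 : ℝ) : EP) := by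
  have hφd : MDifferentiableAt 𝓘(ℝ, ℝ) 𝓘(ℝ, ℝ) φ u := hφ.differentiableAt.mdifferentiableAt
  have h1 := congrArg (fun L => L (1 : ℝ))
    (mfderiv_comp (I := 𝓘(ℝ, ℝ)) (I' := 𝓘(ℝ, ℝ)) (I'' := 𝓘(ℝ, EP)) u hc hφd)
  have h2 : (mfderiv 𝓘(ℝ, ℝ) 𝓘(ℝ, ℝ) φ u (1 : ℝ) : ℝ) = ε • (1 : ℝ) := by
    rw [mfderiv_eq_fderiv, smul_eq_mul, mul_one]
    exact hφ.deriv
  exact h1.trans ((congrArg (mfderiv 𝓘(ℝ, ℝ) 𝓘(ℝ, EP) c (φ u)) h2).trans (map_smul _ _ _))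

theorem TangentBundle.eq_mk_of_proj_eq {z : TangentBundle 𝓘(ℝ, EP) P} {p : P}
    (h : z.proj = p) : z = (⟨p, (z.snd : EP)⟩ : TangentBundle 𝓘(ℝ, EP) P) := by
  subst h; rfl

namespace ConnectionForm

variable [IsManifold 𝓘(ℝ, EP) ∞ P] {B : PrincipalBundle EG EP EM G P M} (A : ConnectionForm B)

/-- The path `c` is differentiable and horizontal at `t`, and the vector field `v` along `c`
satisfies the tangency condition at `t`, with the curvature replaced by the exterior derivative. -/
structure IsTangentAt (c : ℝ → P) (v : ℝ → TangentBundle 𝓘(ℝ, EP) P) (t : ℝ) : Prop where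
  mdifferentiableAt : MDifferentiableAt 𝓘(ℝ, ℝ) 𝓘(ℝ, EP) c t
  horizontal : A.form (c t) (mfderiv 𝓘(ℝ, ℝ) 𝓘(ℝ, EP) c t (1 : ℝ)) = 0
  hasDerivAt : HasDerivAt (F := EG) (fun s => A.form (v s).proj (v s).snd)
    (extDerivOneForm (F := EG) A.form (c t) (mfderiv 𝓘(ℝ, ℝ) 𝓘(ℝ, EP) c t (1 : ℝ))
      ((v t).snd : EP)) t

variable {A}

theorem IsTangentAt.congr_of_eventuallyEq {c c' : ℝ → P} {v v' : ℝ → TangentBundle 𝓘(ℝ, EP) P}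
    {t : ℝ} (h : A.IsTangentAt c v t) (hc : c' =ᶠ[𝓝 t] c) (hv : v' =ᶠ[𝓝 t] v) :
    A.IsTangentAt c' v' t := by
  have hcongr : ∀ q : P, q = c t → ∀ w u : EP, A.form q w = A.form (c t) w ∧
      extDerivOneForm (F := EG) A.form q w u = extDerivOneForm (F := EG) A.form (c t) w u := by
    rintro _ rfl _ _; exact ⟨rfl, rfl⟩
  have hcongr' : ∀ z z' : TangentBundle 𝓘(ℝ, EP) P, z = z' → (z.snd : EP) = z'.snd := by
    rintro _ _ rfl; rfl
  have hd : (mfderiv 𝓘(ℝ, ℝ) 𝓘(ℝ, EP) c' t (1 : ℝ) : EP) =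
      mfderiv 𝓘(ℝ, ℝ) 𝓘(ℝ, EP) c t (1 : ℝ) :=
    congrArg (fun L : ℝ →L[ℝ] EP => L 1) (hc.mfderiv_eq (I := 𝓘(ℝ, ℝ)) (I' := 𝓘(ℝ, EP)))
  refine ⟨h.mdifferentiableAt.congr_of_eventuallyEq hc, ?_, ?_⟩
  · exact (hcongr _ hc.self_of_nhds _ 0).1.trans ((congrArg (A.form (c t)) hd).trans h.horizontal)
  · have e : extDerivOneForm (F := EG) A.form (c' t) (mfderiv 𝓘(ℝ, ℝ) 𝓘(ℝ, EP) c' t (1 : ℝ))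
        ((v' t).snd : EP) = extDerivOneForm (F := EG) A.form (c t)
          (mfderiv 𝓘(ℝ, ℝ) 𝓘(ℝ, EP) c t (1 : ℝ)) ((v t).snd : EP) :=
      (hcongr _ hc.self_of_nhds _ _).2.trans (congrArg₂ (fun a b : EP =>
        extDerivOneForm (F := EG) A.form (c t) a b) hd (hcongr' _ _ hv.self_of_nhds))
    rw [e]
    refine h.hasDerivAt.congr_of_eventuallyEq ?_
    filter_upwards [hv] with s hs
    rw [hs]

/-- The derivative of A(v) and the velocity both pick up the factor `ε`, and dA is linear in the
velocity. Reversal (`ε = -1`) and shift (`ε = 1`) are the cases needed. -/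
theorem IsTangentAt.comp [FiniteDimensional ℝ EP] {c : ℝ → P} {v : ℝ → TangentBundle 𝓘(ℝ, EP) P}
    {φ : ℝ → ℝ} {u ε : ℝ} (h : A.IsTangentAt c v (φ u)) (hφ : HasDerivAt φ ε u) :
    A.IsTangentAt (c ∘ φ) (v ∘ φ) u := by
  have hd := mfderiv_comp_real h.mdifferentiableAt hφ
  refine ⟨h.mdifferentiableAt.comp u hφ.differentiableAt.mdifferentiableAt, ?_, ?_⟩
  · refine (congrArg (A.form (c (φ u))) hd).trans ((map_smul (A.form (c (φ u))) _ _).trans ?_)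
    exact (congrArg (ε • ·) h.horizontal).trans (smul_zero _)
  · have e : extDerivOneForm (F := EG) A.form ((c ∘ φ) u)
        (mfderiv 𝓘(ℝ, ℝ) 𝓘(ℝ, EP) (c ∘ φ) u (1 : ℝ)) (((v ∘ φ) u).snd : EP) =
        ε • extDerivOneForm (F := EG) A.form (c (φ u))
          (mfderiv 𝓘(ℝ, ℝ) 𝓘(ℝ, EP) c (φ u) (1 : ℝ)) ((v (φ u)).snd : EP) :=
      (congrArg (fun a : EP => extDerivOneForm (F := EG) A.form (c (φ u)) a
        ((v (φ u)).snd : EP)) hd).trans (extDerivOneForm_smul_left (F := EG) A.contMDiff_form _ _ _)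
    rw [e]
    exact h.hasDerivAt.scomp u hφ

theorem continuousOn_form {v : ℝ → TangentBundle 𝓘(ℝ, EP) P} {s : Set ℝ}
    (hv : ContinuousOn v s) :
    ContinuousOn (fun t => (A.form (v t).proj (v t).snd : EG)) s :=
  A.contMDiff_form.continuous.comp_continuousOn hv

/-- A vector field satisfying the tangency condition along a horizontal path is determined by its
projection to the base and its initial value. -/
theorem eqOn_of_isTangentAt [FiniteDimensional ℝ EG] [FiniteDimensional ℝ EP]
    [LieGroup 𝓘(ℝ, EG) ∞ G] [T2Space P] {c₁ c₂ : ℝ → P}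
    {v₁ v₂ : ℝ → TangentBundle 𝓘(ℝ, EP) P} {a b : ℝ} {s : Set ℝ} (hs : s.Countable)
    (hc₁ : ContinuousOn c₁ (Icc a b)) (hc₂ : ContinuousOn c₂ (Icc a b))
    (hv₁ : ContinuousOn v₁ (Icc a b)) (hv₂ : ContinuousOn v₂ (Icc a b))
    (hcv₁ : ∀ u ∈ Icc a b, (v₁ u).proj = c₁ u) (hcv₂ : ∀ u ∈ Icc a b, (v₂ u).proj = c₂ u)
    (h₁ : ∀ u ∈ Ioo a b \ s, A.IsTangentAt c₁ v₁ u)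
    (h₂ : ∀ u ∈ Ioo a b \ s, A.IsTangentAt c₂ v₂ u)
    (hproj : ∀ u ∈ Icc a b, B.proj (c₁ u) = B.proj (c₂ u))
    (hproj' : ∀ u ∈ Icc a b, tangentMap 𝓘(ℝ, EP) 𝓘(ℝ, EM) B.proj (v₁ u) =
      tangentMap 𝓘(ℝ, EP) 𝓘(ℝ, EM) B.proj (v₂ u))
    (hca : c₁ a = c₂ a) (hva : v₁ a = v₂ a) :
    (∀ u ∈ Icc a b, c₁ u = c₂ u) ∧ ∀ u ∈ Icc a b, v₁ u = v₂ u := by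
  have : CompleteSpace EG := FiniteDimensional.complete ℝ EG
  have hc : ∀ u ∈ Icc a b, c₁ u = c₂ u :=
    A.eqOn_of_horizontal hs hc₁ hc₂
      (fun u hu => ⟨(h₁ u hu).mdifferentiableAt, (h₁ u hu).horizontal⟩)
      (fun u hu => ⟨(h₂ u hu).mdifferentiableAt, (h₂ u hu).horizontal⟩) hproj hca
  have hvert : ∀ u ∈ Icc a b, mfderiv 𝓘(ℝ, EP) 𝓘(ℝ, EM) B.proj (c₁ u) ((v₁ u).snd : EP) =
      mfderiv 𝓘(ℝ, EP) 𝓘(ℝ, EM) B.proj (c₁ u) ((v₂ u).snd : EP) := by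
    intro u hu
    have key : ∀ (z z' : TangentBundle 𝓘(ℝ, EP) P) (p : P), z.proj = p → z'.proj = p →
        tangentMap 𝓘(ℝ, EP) 𝓘(ℝ, EM) B.proj z = tangentMap 𝓘(ℝ, EP) 𝓘(ℝ, EM) B.proj z' →
        mfderiv 𝓘(ℝ, EP) 𝓘(ℝ, EM) B.proj p (z.snd : EP) =
          mfderiv 𝓘(ℝ, EP) 𝓘(ℝ, EM) B.proj p (z'.snd : EP) := by
      rintro ⟨p, w⟩ ⟨_, w'⟩ _ rfl rfl h
      exact eq_of_heq (Bundle.TotalSpace.mk.inj h).2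
    exact key _ _ _ (hcv₁ u hu) ((hcv₂ u hu).trans (hc u hu).symm) (hproj' u hu)
  refine ⟨hc, fun y hy => ?_⟩
  have hsub : Icc a y ⊆ Icc a b := Icc_subset_Icc_right hy.2
  have hform : (A.form (v₁ y).proj (v₁ y).snd : EG) - (A.form (v₂ y).proj (v₂ y).snd : EG) =
      (A.form (v₁ a).proj (v₁ a).snd : EG) - (A.form (v₂ a).proj (v₂ a).snd : EG) := by
    refine eq_of_hasDerivAt_zero_off_countable (F := EG) (f := fun u =>
      (A.form (v₁ u).proj (v₁ u).snd : EG) - (A.form (v₂ u).proj (v₂ u).snd : EG)) hy.1 hs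
      ((continuousOn_form (hv₁.mono hsub)).sub (continuousOn_form (hv₂.mono hsub))) ?_
    rintro u ⟨hu, hus⟩
    have huo : u ∈ Ioo a b := ⟨hu.1, hu.2.trans_le hy.2⟩
    have huc := Ioo_subset_Icc_self huo
    have t₁ := h₁ u ⟨huo, hus⟩
    have t₂ := h₂ u ⟨huo, hus⟩
    have heq : c₂ =ᶠ[𝓝 u] c₁ := by
      filter_upwards [Ioo_mem_nhds huo.1 huo.2] with z hz
      exact (hc z (Ioo_subset_Icc_self hz)).symm
    have t₂' := (t₂.congr_of_eventuallyEq heq.symm Filter.EventuallyEq.rfl).hasDerivAt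
    have hz : extDerivOneForm (F := EG) A.form (c₁ u)
        (mfderiv 𝓘(ℝ, ℝ) 𝓘(ℝ, EP) c₁ u (1 : ℝ)) ((v₁ u).snd : EP) -
      extDerivOneForm (F := EG) A.form (c₁ u)
        (mfderiv 𝓘(ℝ, ℝ) 𝓘(ℝ, EP) c₁ u (1 : ℝ)) ((v₂ u).snd : EP) = 0 := by
      -- The difference of the two vectors is vertical and the velocity horizontal, so dA vanishes
      -- on the pair.
      refine (extDerivOneForm_sub_right (F := EG) A.contMDiff_form _ _ _).symm.trans ?_
      refine A.extDerivForm_eq_zero t₁.horizontal ?_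
      exact (map_sub _ _ _).trans (sub_eq_zero.2 (hvert u huc))
    rw [← hz]
    exact t₁.hasDerivAt.sub t₂'
  rw [hva, sub_self, sub_eq_zero] at hform
  have h1 := TangentBundle.eq_mk_of_proj_eq (hcv₁ y hy)
  have h2 := TangentBundle.eq_mk_of_proj_eq ((hcv₂ y hy).trans (hc y hy).symm)
  have hAform : ∀ (z : TangentBundle 𝓘(ℝ, EP) P) (p : P), z.proj = p →
      (A.form z.proj z.snd : EG) = A.form p (z.snd : EP) := by
    rintro z _ rfl; rfl
  have hsnd : ((v₁ y).snd : EP) = (v₂ y).snd :=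
    A.eq_of_form_eq_of_mfderiv_proj_eq (p := c₁ y) ((hAform _ _ (hcv₁ y hy)).symm.trans
      (hform.trans (hAform _ _ ((hcv₂ y hy).trans (hc y hy).symm)))) (hvert y hy)
  rw [h1, h2]
  exact congrArg (fun w : EP => (⟨c₁ y, w⟩ : TangentBundle 𝓘(ℝ, EP) P)) hsnd

end ConnectionForm

end PrincipalBundles

/-- Isolates `t` from the other break points, so that one-sided intervals ending at `t` can be
chosen without break points inside. -/
theorem Finset.exists_pos_forall_le_abs_sub (s : Finset ℝ) (t : ℝ) :
    ∃ ε > 0, ∀ z ∈ s, z ≠ t → ε ≤ |z - t| := by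
  have h : ((s.erase t : Finset ℝ) : Set ℝ)ᶜ ∈ 𝓝 t :=
    (s.erase t).finite_toSet.isClosed.isOpen_compl.mem_nhds (by simp)
  obtain ⟨ε, hε, hball⟩ := Metric.mem_nhds_iff.1 h
  refine ⟨ε, hε, fun z hz hzt => ?_⟩
  by_contra! hlt
  exact hball (show z ∈ Metric.ball t ε by rwa [Metric.mem_ball, Real.dist_eq])
    (by simp [hz, hzt])

/-! ### Backtracking as a reflection, and regularity of erased paths -/

section Erasure

theorem BacktracksOver.pos {X : Type*} {c : ℝ → X} {t₀ t₁ T δ : ℝ}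
    (h : BacktracksOver c t₀ t₁ T δ) : 0 < δ := by
  linarith [h.2.1]

theorem BacktracksOver.apply_add {X : Type*} {c : ℝ → X} {t₀ t₁ T δ : ℝ}
    (h : BacktracksOver c t₀ t₁ T δ) : c (T + 2 * δ) = c T := by
  simpa using (h.2.2.2 0 ⟨le_rfl, h.pos.le⟩).symm

/-- Substituting u ↦ δ - u recentres the condition at the turning point, where the two halves share
their initial value. -/
theorem BacktracksOver.apply_mid_add {X : Type*} {c : ℝ → X} {t₀ t₁ T δ : ℝ}
    (h : BacktracksOver c t₀ t₁ T δ) : ∀ u ∈ Icc 0 δ, c (T + δ + u) = c (T + δ - u) := by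
  intro u hu
  have := h.2.2.2 (δ - u) ⟨by linarith [hu.2], by linarith [hu.1]⟩
  rw [show T + δ + u = T + 2 * δ - (δ - u) by ring, ← this]
  congr 1
  ring

theorem BacktracksOver.of_apply_mid_add {X : Type*} {c : ℝ → X} {t₀ t₁ T δ : ℝ}
    (hT : t₀ ≤ T) (hδ : 0 < δ) (hT' : T + 2 * δ < t₁)
    (h : ∀ u ∈ Icc 0 δ, c (T + δ + u) = c (T + δ - u)) : BacktracksOver c t₀ t₁ T δ := by
  refine ⟨hT, by linarith, hT', fun u hu => ?_⟩
  have := h (δ - u) ⟨by linarith [hu.2], by linarith [hu.1]⟩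
  rw [show T + 2 * δ - u = T + δ + (δ - u) by ring, this]
  congr 1
  ring

theorem eraseBacktrack_of_le {X : Type*} {c : ℝ → X} {T δ t : ℝ} (h : t ≤ T) :
    eraseBacktrack c T δ t = c t :=
  if_pos h

/-- The two branches agree at `T` itself because `c (T + 2 * δ) = c T`; this makes the erased map
continuous. -/
theorem BacktracksOver.eraseBacktrack_of_ge {X : Type*} {c : ℝ → X} {t₀ t₁ T δ t : ℝ}
    (h : BacktracksOver c t₀ t₁ T δ) (ht : T ≤ t) :
    eraseBacktrack c T δ t = c (t + 2 * δ) := by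
  rcases ht.eq_or_lt with rfl | ht
  · rw [eraseBacktrack_of_le le_rfl, h.apply_add]
  · exact if_neg ht.not_ge

theorem BacktracksOver.continuousOn_eraseBacktrack {X : Type*} [TopologicalSpace X] {c : ℝ → X}
    {t₀ t₁ T δ : ℝ} (h : BacktracksOver c t₀ t₁ T δ) (hc : ContinuousOn c (Icc t₀ t₁)) :
    ContinuousOn (eraseBacktrack c T δ) (Icc t₀ (t₁ - 2 * δ)) := by
  have h1 : t₀ ≤ T := h.1
  have h2 : T ≤ t₁ - 2 * δ := by linarith [h.2.2.1]
  have hδ := h.pos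
  rw [← Icc_union_Icc_eq_Icc h1 h2]
  refine ContinuousOn.union_of_isClosed ?_ ?_ isClosed_Icc isClosed_Icc
  · refine (hc.mono (Icc_subset_Icc_right (by linarith))).congr fun t ht => ?_
    exact eraseBacktrack_of_le ht.2
  · refine ContinuousOn.congr (f := fun t => c (t + 2 * δ)) ?_ fun t ht =>
      h.eraseBacktrack_of_ge ht.1
    exact hc.comp (by fun_prop) fun t ht => ⟨by linarith [ht.1], by linarith [ht.2]⟩

variable {E : Type*} [NormedAddCommGroup E] [NormedSpace ℝ E]
  {X : Type*} [TopologicalSpace X] [ChartedSpace E X]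

theorem BacktracksOver.isPiecewiseC1_eraseBacktrack {c : ℝ → X} {t₀ t₁ T δ : ℝ}
    (h : BacktracksOver c t₀ t₁ T δ) (hc : IsPiecewiseC1 (E := E) c t₀ t₁) :
    IsPiecewiseC1 (E := E) (eraseBacktrack c T δ) t₀ (t₁ - 2 * δ) := by
  classical
  obtain ⟨hcont, s, hs⟩ := hc
  have hδ := h.pos
  have hT := h.2.2.1
  -- Break points of the erased path: the junction `T`, the old ones for the part before it, and the
  -- old ones moved back by `2 * δ` for the part after it.
  refine ⟨h.continuousOn_eraseBacktrack hcont, insert T (s ∪ s.image (· - 2 * δ)), ?_⟩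
  intro x y hxy hsub hdisj
  have hx := hsub (left_mem_Icc.2 hxy.le)
  have hy := hsub (right_mem_Icc.2 hxy.le)
  rw [Set.disjoint_left] at hdisj
  by_cases hyT : y ≤ T
  · refine (hs x y hxy (Icc_subset_Icc hx.1 (by linarith)) ?_).congr fun t ht =>
      eraseBacktrack_of_le (ht.2.trans hyT)
    rw [Set.disjoint_left]
    intro z hz hzs
    exact hdisj hz (by simp [Finset.mem_coe.1 hzs])
  · have hTx : T ≤ x := by
      by_contra! hlt
      exact hdisj (a := T) ⟨hlt, not_le.1 hyT⟩ (by simp)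
    have hshift : ContMDiffOn 𝓘(ℝ, ℝ) 𝓘(ℝ, E) 1 c (Icc (x + 2 * δ) (y + 2 * δ)) := by
      refine hs _ _ (by linarith) (Icc_subset_Icc (by linarith [hx.1]) (by linarith [hy.2])) ?_
      rw [Set.disjoint_left]
      intro z hz hzs
      refine hdisj (a := z - 2 * δ) ⟨by linarith [hz.1], by linarith [hz.2]⟩ ?_
      simp [Finset.mem_coe.1 hzs]
    have hadd : ContMDiff 𝓘(ℝ, ℝ) 𝓘(ℝ, ℝ) 1 (fun t : ℝ => t + 2 * δ) :=
      (contDiff_id.add contDiff_const).contMDiff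
    refine (hshift.comp hadd.contMDiffOn fun t ht => ?_).congr fun t ht =>
      h.eraseBacktrack_of_ge (hTx.trans ht.1)
    exact ⟨by linarith [ht.1], by linarith [ht.2]⟩

end Erasure

/-! ### Conditions at the break points, and the conclusion -/

section PrincipalBundles

variable {EG : Type*} [NormedAddCommGroup EG] [NormedSpace ℝ EG]
  {EP : Type*} [NormedAddCommGroup EP] [NormedSpace ℝ EP]
  {EM : Type*} [NormedAddCommGroup EM] [NormedSpace ℝ EM]
  {G : Type*} [TopologicalSpace G] [ChartedSpace EG G] [Group G]
  {P : Type*} [TopologicalSpace P] [ChartedSpace EP P]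
  {M : Type*} [TopologicalSpace M] [ChartedSpace EM M]

namespace ConnectionForm

variable [IsManifold 𝓘(ℝ, EP) ∞ P] {B : PrincipalBundle EG EP EM G P M} {A : ConnectionForm B}

/-- At interior points derivatives within the interval are ordinary ones, and horizontality reduces
the curvature to dA. -/
theorem isTangentAt_of_tangencyCondition {c : ℝ → P} {v : ℝ → TangentBundle 𝓘(ℝ, EP) P}
    {a b : ℝ} (hor : A.IsHorizontal c a b) (hv : ∀ t ∈ Icc a b, (v t).proj = c t)
    (htan : A.TangencyCondition c v a b) {t : ℝ} (ht : t ∈ Ioo a b)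
    (hc : MDifferentiableAt 𝓘(ℝ, ℝ) 𝓘(ℝ, EP) c t) : A.IsTangentAt c v t := by
  have htI := Ioo_subset_Icc_self ht
  have hnhds : Icc a b ∈ 𝓝 t := Icc_mem_nhds ht.1 ht.2
  have hvel : HasVelocityAt (E := EP) c a b t := hc.mdifferentiableWithinAt
  have hveleq : velocity (E := EP) c a b t = mfderiv 𝓘(ℝ, ℝ) 𝓘(ℝ, EP) c t (1 : ℝ) := by
    unfold velocity
    rw [mfderivWithin_of_mem_nhds hnhds]
  have h1 := hor t htI hvel
  have h2 := HasDerivWithinAt.hasDerivAt (F := EG) (htan t htI hvel ((v t).snd : EP)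
    (TangentBundle.eq_mk_of_proj_eq (hv t htI))) hnhds
  have e : (A.curvature (c t) (velocity (E := EP) c a b t) ((v t).snd : EP) : EG) =
      extDerivOneForm (F := EG) A.form (c t) (mfderiv 𝓘(ℝ, ℝ) 𝓘(ℝ, EP) c t (1 : ℝ))
        ((v t).snd : EP) :=
    (A.curvature_of_horizontal h1).trans (congrArg (fun u : EP =>
      extDerivOneForm (F := EG) A.form (c t) u ((v t).snd : EP)) hveleq)
  exact ⟨hc, (congrArg (A.form (c t)) hveleq).symm.trans h1, h2.congr_deriv e⟩

theorem exists_isTangentAt {c : ℝ → P} {v : ℝ → TangentBundle 𝓘(ℝ, EP) P} {a b : ℝ}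
    (hc : IsPiecewiseC1 (E := EP) c a b)
    (hor : A.IsHorizontal c a b) (hv : ∀ t ∈ Icc a b, (v t).proj = c t)
    (htan : A.TangencyCondition c v a b) :
    ∃ s : Finset ℝ, ∀ t ∈ Ioo a b \ (s : Set ℝ), A.IsTangentAt c v t := by
  obtain ⟨-, s, hs⟩ := hc
  refine ⟨s, fun t ⟨ht, hts⟩ => isTangentAt_of_tangencyCondition hor hv htan ht ?_⟩
  have hnhds : Ioo a b ∩ (s : Set ℝ)ᶜ ∈ 𝓝 t :=
    (isOpen_Ioo.inter s.finite_toSet.isClosed.isOpen_compl).mem_nhds ⟨ht, hts⟩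
  obtain ⟨ε, hε, hball⟩ := Metric.nhds_basis_closedBall.mem_iff.1 hnhds
  rw [Real.closedBall_eq_Icc] at hball
  have h1 := hs (t - ε) (t + ε) (by linarith)
    (fun z hz => Ioo_subset_Icc_self (hball hz).1)
    (Set.disjoint_left.2 fun z hz => (hball (Ioo_subset_Icc_self hz)).2)
  exact (h1.contMDiffAt (Icc_mem_nhds (by linarith) (by linarith))).mdifferentiableAt (by simp)

/-- On a closed interval on which `c` is `C¹`, the conditions at the interior points extend to
the end points, with one-sided derivatives. -/
theorem one_sided_of_isTangentAt [FiniteDimensional ℝ EP]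
    {c : ℝ → P} {v : ℝ → TangentBundle 𝓘(ℝ, EP) P} {x y : ℝ} (hxy : x < y)
    (hc : ContMDiffOn 𝓘(ℝ, ℝ) 𝓘(ℝ, EP) 1 c (Icc x y)) (hv : ContinuousOn v (Icc x y))
    (hcv : ∀ t ∈ Icc x y, (v t).proj = c t) (h : ∀ t ∈ Ioo x y, A.IsTangentAt c v t) :
    (∀ t ∈ Icc x y, A.form (c t) (mfderivWithin 𝓘(ℝ, ℝ) 𝓘(ℝ, EP) c (Icc x y) t (1 : ℝ)) = 0) ∧
    HasDerivWithinAt (F := EG) (fun s => A.form (v s).proj (v s).snd)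
      (extDerivOneForm (F := EG) A.form (c x)
        (mfderivWithin 𝓘(ℝ, ℝ) 𝓘(ℝ, EP) c (Icc x y) x (1 : ℝ)) ((v x).snd : EP)) (Ici x) x ∧
    HasDerivWithinAt (F := EG) (fun s => A.form (v s).proj (v s).snd)
      (extDerivOneForm (F := EG) A.form (c y)
        (mfderivWithin 𝓘(ℝ, ℝ) 𝓘(ℝ, EP) c (Icc x y) y (1 : ℝ)) ((v y).snd : EP)) (Iic y) y := by
  have huniq : UniqueMDiffOn 𝓘(ℝ, ℝ) (Icc x y) :=
    uniqueMDiffOn_iff_uniqueDiffOn.2 (uniqueDiffOn_Icc hxy)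
  set V : ℝ → TangentBundle 𝓘(ℝ, EP) P := fun t =>
    tangentMapWithin 𝓘(ℝ, ℝ) 𝓘(ℝ, EP) c (Icc x y) ⟨t, (1 : ℝ)⟩ with hV
  have hone : Continuous (fun t : ℝ => (⟨t, (1 : ℝ)⟩ : TangentBundle 𝓘(ℝ, ℝ) ℝ)) :=
    (contMDiff_vectorSpace_iff_contDiff (n := 0) (V := fun _ : ℝ => (1 : ℝ))).2
      contDiff_const |>.continuous
  have hVc : ContinuousOn V (Icc x y) :=
    (hc.continuousOn_tangentMapWithin le_rfl huniq).comp hone.continuousOn fun t ht => ht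
  have hint : ∀ t ∈ Ioo x y, (mfderivWithin 𝓘(ℝ, ℝ) 𝓘(ℝ, EP) c (Icc x y) t (1 : ℝ) : EP) =
      mfderiv 𝓘(ℝ, ℝ) 𝓘(ℝ, EP) c t (1 : ℝ) := fun t ht => by
    rw [mfderivWithin_of_mem_nhds (Icc_mem_nhds ht.1 ht.2)]
  -- A(c') is continuous on the closed piece and vanishes on its interior, hence also at the ends.
  have hzero : EqOn (fun t => (A.form (V t).proj (V t).snd : EG)) (fun _ => 0) (Icc x y) := by
    refine Set.EqOn.of_subset_closure (Y := EG) (s := Ioo x y) (fun t ht => ?_)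
      (continuousOn_form hVc) continuousOn_const Ioo_subset_Icc_self (closure_Ioo hxy.ne).ge
    exact (congrArg (A.form (c t)) (hint t ht)).trans (h t ht).horizontal
  set D : ℝ → EG := fun t => extDerivOneForm (F := EG) A.form (V t).proj (V t).snd (v t).snd
    with hD
  have hDc : ContinuousOn D (Icc x y) := fun t ht =>
    ContinuousWithinAt.extDerivOneForm (F := EG) A.contMDiff_form (hVc t ht) (hv t ht) ht hcv
  have hderiv : ∀ t ∈ Ioo x y,
      HasDerivAt (F := EG) (fun s => A.form (v s).proj (v s).snd) (D t) t := fun t ht => by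
    have e : D t = extDerivOneForm (F := EG) A.form (c t)
        (mfderiv 𝓘(ℝ, ℝ) 𝓘(ℝ, EP) c t (1 : ℝ)) ((v t).snd : EP) :=
      congrArg (fun u : EP => extDerivOneForm (F := EG) A.form (c t) u ((v t).snd : EP))
        (hint t ht)
    rw [e]
    exact (h t ht).hasDerivAt
  have hg : ContinuousOn (fun s => (A.form (v s).proj (v s).snd : EG)) (Icc x y) :=
    continuousOn_form hv
  have hdiff : DifferentiableOn ℝ (fun s => (A.form (v s).proj (v s).snd : EG)) (Ioo x y) :=
    fun t ht => (hderiv t ht).differentiableAt.differentiableWithinAt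
  refine ⟨hzero, ?_, ?_⟩
  -- A continuous function whose derivative has a limit at an end point has that limit as its
  -- one-sided derivative.
  · refine hasDerivWithinAt_Ici_of_tendsto_deriv (E := EG) hdiff
      ((hg x (left_mem_Icc.2 hxy.le)).mono Ioo_subset_Icc_self) (Ioo_mem_nhdsGT hxy) ?_
    have h1 : Filter.Tendsto D (𝓝[>] x) (𝓝 (D x)) := by
      rw [← nhdsWithin_Ioo_eq_nhdsGT hxy]
      exact (hDc x (left_mem_Icc.2 hxy.le)).mono Ioo_subset_Icc_self
    refine h1.congr' ?_
    filter_upwards [Ioo_mem_nhdsGT hxy] with t ht using (hderiv t ht).deriv.symm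
  · refine hasDerivWithinAt_Iic_of_tendsto_deriv (E := EG) hdiff
      ((hg y (right_mem_Icc.2 hxy.le)).mono Ioo_subset_Icc_self) (Ioo_mem_nhdsLT hxy) ?_
    have h1 : Filter.Tendsto D (𝓝[<] y) (𝓝 (D y)) := by
      rw [← nhdsWithin_Ioo_eq_nhdsLT hxy]
      exact (hDc y (right_mem_Icc.2 hxy.le)).mono Ioo_subset_Icc_self
    refine h1.congr' ?_
    filter_upwards [Ioo_mem_nhdsLT hxy] with t ht using (hderiv t ht).deriv.symm

/-- The conditions are also required at those exceptional points where a velocity happens to exist.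
That velocity is then the one-sided velocity of each adjoining C¹ piece, so the one-sided statements
have the same value and combine. -/
theorem isHorizontal_and_tangencyCondition_of_isTangentAt [FiniteDimensional ℝ EP]
    {c : ℝ → P} {v : ℝ → TangentBundle 𝓘(ℝ, EP) P} {a b : ℝ} (hab : a < b)
    (hc : IsPiecewiseC1 (E := EP) c a b) (hv : IsContinuousFieldAlong c v a b) {s : Finset ℝ}
    (h : ∀ t ∈ Ioo a b \ (s : Set ℝ), A.IsTangentAt c v t) :
    A.IsHorizontal c a b ∧ A.TangencyCondition c v a b := by
  classical
  obtain ⟨-, s', hs'⟩ := hc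
  obtain ⟨hvc, hvp⟩ := hv
  have piece : ∀ x y, x < y → Icc x y ⊆ Icc a b → (∀ z ∈ s ∪ s', z ∉ Ioo x y) →
      ContMDiffOn 𝓘(ℝ, ℝ) 𝓘(ℝ, EP) 1 c (Icc x y) ∧ ∀ t ∈ Ioo x y, A.IsTangentAt c v t := by
    intro x y hxy hsub hz
    refine ⟨hs' x y hxy hsub (Set.disjoint_right.2 fun z hzs => hz z
      (Finset.mem_union_right _ hzs)), fun t ht => h t ⟨?_, fun hts => hz t
        (Finset.mem_union_left _ hts) ht⟩⟩
    exact ⟨(hsub (left_mem_Icc.2 hxy.le)).1.trans_lt ht.1,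
      ht.2.trans_le (hsub (right_mem_Icc.2 hxy.le)).2⟩
  have main : ∀ t ∈ Icc a b, HasVelocityAt (E := EP) c a b t →
      A.form (c t) (velocity (E := EP) c a b t) = 0 ∧
      HasDerivWithinAt (F := EG) (fun s => A.form (v s).proj (v s).snd)
        (extDerivOneForm (F := EG) A.form (c t) (velocity (E := EP) c a b t) ((v t).snd : EP))
        (Icc a b) t := by
    intro t ht hvel
    have hmono : ∀ x y, x < y → Icc x y ⊆ Icc a b → t ∈ Icc x y →
        (mfderivWithin 𝓘(ℝ, ℝ) 𝓘(ℝ, EP) c (Icc x y) t (1 : ℝ) : EP) =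
          velocity (E := EP) c a b t := by
      intro x y hxy hsub htxy
      have huniq : UniqueMDiffWithinAt 𝓘(ℝ, ℝ) (Icc x y) t :=
        uniqueMDiffWithinAt_iff_uniqueDiffWithinAt.2 (uniqueDiffOn_Icc hxy t htxy)
      unfold velocity
      rw [MDifferentiableWithinAt.mfderivWithin_mono hvel huniq hsub]
    obtain ⟨ε, hε, hgap⟩ := (s ∪ s').exists_pos_forall_le_abs_sub t
    have right : t < b → A.form (c t) (velocity (E := EP) c a b t) = 0 ∧
        HasDerivWithinAt (F := EG) (fun s => A.form (v s).proj (v s).snd)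
        (extDerivOneForm (F := EG) A.form (c t) (velocity (E := EP) c a b t) ((v t).snd : EP))
        (Ici t) t := by
      intro htb
      -- No exceptional point lies strictly within `ε` of `t`, except possibly `t` itself, so the
      -- path is C¹ up to this right end.
      have hlt : t < min b (t + ε) := lt_min htb (by linarith)
      have hsub : Icc t (min b (t + ε)) ⊆ Icc a b := Icc_subset_Icc ht.1 (min_le_left _ _)
      obtain ⟨h1, h2⟩ := piece _ _ hlt hsub fun z hz hzI => by
        have h3 := hgap z hz hzI.1.ne'
        rw [abs_of_pos (sub_pos.2 hzI.1)] at h3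
        have h4 := hzI.2.trans_le (min_le_right _ _)
        linarith
      obtain ⟨h5, h6, -⟩ := one_sided_of_isTangentAt hlt h1 (hvc.mono hsub)
        (fun u hu => hvp u (hsub hu)) h2
      have htI := left_mem_Icc.2 hlt.le
      have e := hmono _ _ hlt hsub htI
      have h5' := h5 t htI
      rw [e] at h5' h6
      exact ⟨h5', h6⟩
    have left : a < t → A.form (c t) (velocity (E := EP) c a b t) = 0 ∧
        HasDerivWithinAt (F := EG) (fun s => A.form (v s).proj (v s).snd)
        (extDerivOneForm (F := EG) A.form (c t) (velocity (E := EP) c a b t) ((v t).snd : EP))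
        (Iic t) t := by
      intro hta
      have hlt : max a (t - ε) < t := max_lt hta (by linarith)
      have hsub : Icc (max a (t - ε)) t ⊆ Icc a b := Icc_subset_Icc (le_max_left _ _) ht.2
      obtain ⟨h1, h2⟩ := piece _ _ hlt hsub fun z hz hzI => by
        have h3 := hgap z hz hzI.2.ne
        rw [abs_of_neg (sub_neg.2 hzI.2)] at h3
        have h4 := (le_max_right a (t - ε)).trans_lt hzI.1
        linarith
      obtain ⟨h5, -, h6⟩ := one_sided_of_isTangentAt hlt h1 (hvc.mono hsub)
        (fun u hu => hvp u (hsub hu)) h2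
      have htI := right_mem_Icc.2 hlt.le
      have e := hmono _ _ hlt hsub htI
      have h5' := h5 t htI
      rw [e] at h5' h6
      exact ⟨h5', h6⟩
    rcases ht.1.eq_or_lt with rfl | hta
    · exact ⟨(right hab).1, (right hab).2.mono Icc_subset_Ici_self⟩
    rcases ht.2.eq_or_lt with rfl | htb
    · exact ⟨(left hab).1, (left hab).2.mono Icc_subset_Iic_self⟩
    refine ⟨(right htb).1, ?_⟩
    exact ((left hta).2.union (right htb).2).mono fun z _ => le_total z t
  refine ⟨fun t ht hvel => (main t ht hvel).1, fun t ht hvel w hw => ?_⟩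
  obtain ⟨h1, h2⟩ := main t ht hvel
  have hwv : ((v t).snd : EP) = w := by
    have : ∀ z z' : TangentBundle 𝓘(ℝ, EP) P, z = z' → (z.snd : EP) = z'.snd := by
      rintro _ _ rfl; rfl
    exact this _ _ hw
  rw [A.curvature_of_horizontal h1]
  rw [hwv] at h2
  exact h2

/-- Uniqueness is applied to the two halves read outward from the turning point: they start at the
same vector and have equal projections by the reflected form of the hypotheses. -/
theorem backtracksOver_of_proj [FiniteDimensional ℝ EG] [FiniteDimensional ℝ EP]
    [LieGroup 𝓘(ℝ, EG) ∞ G] [T2Space P]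
    {c : ℝ → P} {v : ℝ → TangentBundle 𝓘(ℝ, EP) P} {t₀ t₁ T δ : ℝ}
    (hc : ContinuousOn c (Icc t₀ t₁)) (hv : IsContinuousFieldAlong c v t₀ t₁) {s : Finset ℝ}
    (h : ∀ t ∈ Ioo t₀ t₁ \ (s : Set ℝ), A.IsTangentAt c v t)
    (hc_back : BacktracksOver (B.proj ∘ c) t₀ t₁ T δ)
    (hv_back : BacktracksOver (tangentMap 𝓘(ℝ, EP) 𝓘(ℝ, EM) B.proj ∘ v) t₀ t₁ T δ) :
    BacktracksOver c t₀ t₁ T δ ∧ BacktracksOver v t₀ t₁ T δ := by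
  classical
  have hδ := hc_back.pos
  have h0 := hc_back.1
  have h1 := hc_back.2.2.1
  have m₁ : MapsTo (fun u => T + δ + u) (Icc 0 δ) (Icc t₀ t₁) := fun u hu =>
    ⟨by linarith [hu.1], by linarith [hu.2]⟩
  have m₂ : MapsTo (fun u => T + δ - u) (Icc 0 δ) (Icc t₀ t₁) := fun u hu =>
    ⟨by linarith [hu.2], by linarith [hu.1]⟩
  have k₁ : ContinuousOn (fun u => T + δ + u) (Icc 0 δ) := by fun_prop
  have k₂ : ContinuousOn (fun u => T + δ - u) (Icc 0 δ) := by fun_prop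
  -- The exceptional times, transported to the parameter `u` by both u ↦ T + δ + u and u ↦ T + δ -
  -- u.
  set s' : Finset ℝ := s.image (fun z => z - (T + δ)) ∪ s.image (fun z => T + δ - z) with hs'
  obtain ⟨hcc, hvv⟩ := eqOn_of_isTangentAt (A := A) (c₁ := c ∘ fun u => T + δ + u)
    (c₂ := c ∘ fun u => T + δ - u) (v₁ := v ∘ fun u => T + δ + u) (v₂ := v ∘ fun u => T + δ - u)
    (a := 0) (b := δ) (s := (s' : Set ℝ)) s'.countable_toSet (hc.comp k₁ m₁) (hc.comp k₂ m₂)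
    (hv.1.comp k₁ m₁) (hv.1.comp k₂ m₂) (fun u hu => hv.2 _ (m₁ hu)) (fun u hu => hv.2 _ (m₂ hu))
    (fun u ⟨hu, hus⟩ => IsTangentAt.comp (φ := fun u => T + δ + u) (h _ ⟨⟨by linarith [hu.1],
      by linarith [hu.2]⟩, fun hmem => hus (Finset.mem_coe.2 (Finset.mem_union_left _
        (Finset.mem_image.2 ⟨_, hmem, by ring⟩)))⟩) ((hasDerivAt_id u).const_add (T + δ)))
    (fun u ⟨hu, hus⟩ => IsTangentAt.comp (φ := fun u => T + δ - u) (h _ ⟨⟨by linarith [hu.2],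
      by linarith [hu.1]⟩, fun hmem => hus (Finset.mem_coe.2 (Finset.mem_union_right _
        (Finset.mem_image.2 ⟨_, hmem, by ring⟩)))⟩) ((hasDerivAt_id u).const_sub (T + δ)))
    hc_back.apply_mid_add hv_back.apply_mid_add (by simp) (by simp)
  exact ⟨.of_apply_mid_add hc_back.1 hδ hc_back.2.2.1 hcc,
    .of_apply_mid_add hc_back.1 hδ hc_back.2.2.1 hvv⟩

/-- Away from `T` the erased maps coincide, on a whole neighbourhood, either with the originals or
with their shifts by `2 * δ`. -/
theorem isTangentAt_eraseBacktrack [FiniteDimensional ℝ EP]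
    {c : ℝ → P} {v : ℝ → TangentBundle 𝓘(ℝ, EP) P} {t₀ t₁ T δ : ℝ} (hδ : 0 ≤ δ) {s : Finset ℝ}
    (h : ∀ t ∈ Ioo t₀ t₁ \ (s : Set ℝ), A.IsTangentAt c v t) {t : ℝ}
    (ht : t ∈ Ioo t₀ (t₁ - 2 * δ) \ (insert T (s ∪ s.image (· - 2 * δ)) : Finset ℝ)) :
    A.IsTangentAt (eraseBacktrack c T δ) (eraseBacktrack v T δ) t := by
  obtain ⟨ht, hts⟩ := ht
  simp only [Finset.coe_insert, Finset.coe_union, mem_insert_iff, mem_union, not_or,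
    Finset.coe_image, mem_image, not_exists, not_and] at hts
  obtain ⟨htT, hts, hts'⟩ := hts
  rcases lt_or_gt_of_ne htT with hlt | hgt
  · have hev : ∀ᶠ z in 𝓝 t, z ≤ T := eventually_le_nhds hlt
    exact (h t ⟨⟨ht.1, by linarith [ht.2]⟩, hts⟩).congr_of_eventuallyEq
      (hev.mono fun z hz => if_pos hz) (hev.mono fun z hz => if_pos hz)
  · have hev : ∀ᶠ z in 𝓝 t, T < z := eventually_gt_nhds hgt
    have h1 : A.IsTangentAt c v (t + 2 * δ) :=
      h _ ⟨⟨by linarith [ht.1], by linarith [ht.2]⟩, fun hmem => hts' _ hmem (by ring)⟩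
    exact (IsTangentAt.comp (φ := fun z => z + 2 * δ) h1
      ((hasDerivAt_id t).add_const (2 * δ))).congr_of_eventuallyEq
      (hev.mono fun z hz => if_neg hz.not_ge) (hev.mono fun z hz => if_neg hz.not_ge)

end ConnectionForm

end PrincipalBundles

theorem propositionP
    {EG : Type*} [NormedAddCommGroup EG] [NormedSpace ℝ EG] [FiniteDimensional ℝ EG]
    {EP : Type*} [NormedAddCommGroup EP] [NormedSpace ℝ EP] [FiniteDimensional ℝ EP]
    {EM : Type*} [NormedAddCommGroup EM] [NormedSpace ℝ EM] [FiniteDimensional ℝ EM]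
    {G : Type*} [TopologicalSpace G] [T2Space G] [ChartedSpace EG G] [Group G]
    [LieGroup 𝓘(ℝ, EG) ∞ G]
    {P : Type*} [TopologicalSpace P] [T2Space P] [ChartedSpace EP P] [IsManifold 𝓘(ℝ, EP) ∞ P]
    {M : Type*} [TopologicalSpace M] [T2Space M] [ChartedSpace EM M] [IsManifold 𝓘(ℝ, EM) ∞ M]
    (B : PrincipalBundle EG EP EM G P M) (A : ConnectionForm B)
    (t₀ t₁ T δ : ℝ)
    (c : ℝ → P) (hc : IsPiecewiseC1 (E := EP) c t₀ t₁) (hc_hor : A.IsHorizontal c t₀ t₁)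
    (v : ℝ → TangentBundle 𝓘(ℝ, EP) P) (hv : IsContinuousFieldAlong c v t₀ t₁)
    (hv_tan : A.TangencyCondition c v t₀ t₁)
    (hc_back : BacktracksOver (B.proj ∘ c) t₀ t₁ T δ)
    (hv_back : BacktracksOver (tangentMap 𝓘(ℝ, EP) 𝓘(ℝ, EM) B.proj ∘ v) t₀ t₁ T δ) :
    BacktracksOver c t₀ t₁ T δ ∧
    BacktracksOver v t₀ t₁ T δ ∧
    (IsPiecewiseC1 (E := EP) (eraseBacktrack c T δ) t₀ (t₁ - 2 * δ) ∧
      A.IsHorizontal (eraseBacktrack c T δ) t₀ (t₁ - 2 * δ) ∧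
      IsContinuousFieldAlong (eraseBacktrack c T δ) (eraseBacktrack v T δ) t₀ (t₁ - 2 * δ) ∧
      A.TangencyCondition (eraseBacktrack c T δ) (eraseBacktrack v T δ) t₀ (t₁ - 2 * δ)) := by
  obtain ⟨s, hs⟩ := ConnectionForm.exists_isTangentAt hc hc_hor hv.2 hv_tan
  obtain ⟨hcb, hvb⟩ := ConnectionForm.backtracksOver_of_proj hc.1 hv hs hc_back hv_back
  have hδ := hcb.pos
  have hpc := hcb.isPiecewiseC1_eraseBacktrack hc
  have hfield : IsContinuousFieldAlong (eraseBacktrack c T δ) (eraseBacktrack v T δ) t₀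
      (t₁ - 2 * δ) := by
    refine ⟨hvb.continuousOn_eraseBacktrack hv.1, fun t ht => ?_⟩
    rcases le_total t T with h | h
    · rw [eraseBacktrack_of_le h, eraseBacktrack_of_le h]
      exact hv.2 t ⟨ht.1, by linarith [ht.2]⟩
    · rw [hcb.eraseBacktrack_of_ge h, hvb.eraseBacktrack_of_ge h]
      exact hv.2 _ ⟨by linarith [ht.1], by linarith [ht.2]⟩
  -- The strict inequality `T + 2 * δ < t₁` keeps the erased interval nondegenerate, so that
  -- one-sided derivatives at its ends make sense.
  have hlt : t₀ < t₁ - 2 * δ := by linarith [hcb.1, hcb.2.2.1]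
  obtain ⟨hhor, htan⟩ := ConnectionForm.isHorizontal_and_tangencyCondition_of_isTangentAt hlt hpc
    hfield fun t ht => ConnectionForm.isTangentAt_eraseBacktrack hδ.le hs ht
  exact ⟨hcb, hvb, hpc, hhor, hfield, htan⟩
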